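/- Let $1\le d\le D$ be integers and let $\mathcal M\subset\mathbb R^D$ be a compact $d$-dimensional $C^2$ submanifold without boundary, with reach $\tau$, i.e. $\tau$ is the supremum of all $r\ge 0$ such that every point of $\mathbb R^D$ at distance less than $r$ from $\mathcal M$ has a unique nearest point in $\mathcal M$. For $\sigma>0$ let $\mathcal M_\sigma=\{x\in\mathbb R^D:\inf_{z\in\mathcal M}\|x-z\|<\sigma\}$ and let $U_{\mathcal M_\sigma}$ be the uniform distribution (normalized Lebesgue measure) on $\mathcal M_\sigma$; for $\sigma=0$ let $\mathcal M_0=\mathcal M$ and let $U_{\mathcal M_0}$ be the normalized $d$-dimensional volume of $\mathcal M$. Write $B(y,r)$ for the Euclidean ball of radius $r$ centred at $y$. Let $\sigma\ge 0$, let $Q\subseteq\mathbb R^D$ be a Borel set and suppose that $$B(y,r_1)\subseteq Q\quad\text{and}\quad \mathcal M_\sigma\cap Q\subseteq B(y,r_2)$$ for some $y\in\mathcal M$ and $\sigma<r_1<r_2<\tau/8-\sigma$. Let $Z$ be drawn from $U_{\mathcal M_\sigma}$ conditioned on the event $Z\in Q$, and let $\Sigma$ be the covariance matrix of $Z$, with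 eigenvalues $\lambda_1(\Sigma)\ge\dots\ge\lambda_D(\Sigma)$. (1) Then $$\lambda_d(\Sigma)\ \ge\ \frac{1}{4\left(1+\frac{\sigma}{\tau}\right)^d}\left(\frac{r_1-\sigma}{r_2+\sigma}\right)^d\left(\frac{1-\left(\frac{r_1-\sigma}{2\tau}\right)^2}{1+\left(\frac{2(r_2+\sigma)}{\tau-2(r_2+\sigma)}\right)^2}\right)^{d/2}\frac{(r_1-\sigma)^2}{d}.$$ (2) Let $V_d$ be a subspace corresponding to the first $d$ principal components of $Z$, i.e. a $d$-dimensional linear subspace that minimizes $\mathbb E\|Z-\mathbb EZ-\mathrm{Proj}_V(Z-\mathbb EZ)\|^2$ over all $d$-dimensional linear subspaces $V$ of $\mathbb R^D$, where $\mathrm{Proj}_V$ is the orthogonal projection onto $V$. Then $$\sup_{x\in \mathcal M_\sigma\cap Q}\left\|x-\mathbb EZ-\mathrm{Proj}_{V_d}(x-\mathbb EZ)\right\|\ \le\ 2\sigma+\frac{4r_2^2}{\tau}+\frac{r_2}{r_1-\sigma}\sqrt{4\sigma^2+\frac{16r_2^4}{\tau^2}}\;\gamma(\sigma,\tau,d,r_1,r_2),$$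 where $$\gamma(\sigma,\tau,d,r_1,r_2)=4\sqrt{2d}\left(1+\frac{\sigma}{\tau}\right)^{d/2}\left(\frac{r_2+\sigma}{r_1-\sigma}\right)^{d/2}\left(\frac{1+\left(\frac{2(r_2+\sigma)}{\tau-2(r_2+\sigma)}\right)^2}{1-\left(\frac{r_1-\sigma}{2\tau}\right)^2}\right)^{d/4}.$$ -/

import Mathlib

open MeasureTheory ProbabilityTheory
open scoped ENNReal NNReal

/-- `M` is a `d`-dimensional embedded `C²` submanifold (without boundary) of `ℝ^D`: around each of
its points some `C²` diffeomorphism between open subsets of `ℝ^D` straightens `M` to a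
`d`-dimensional linear subspace. -/
def IsC2Submanifold {D : ℕ} (d : ℕ) (M : Set (EuclideanSpace ℝ (Fin D))) : Prop :=
  ∀ p ∈ M, ∃ (φ : OpenPartialHomeomorph (EuclideanSpace ℝ (Fin D)) (EuclideanSpace ℝ (Fin D)))
    (L : Submodule ℝ (EuclideanSpace ℝ (Fin D))),
    p ∈ φ.source ∧ Module.finrank ℝ L = d ∧
    ContDiffOn ℝ 2 φ φ.source ∧ ContDiffOn ℝ 2 φ.symm φ.target ∧
    φ.source ∩ M = φ.source ∩ φ ⁻¹' (L : Set (EuclideanSpace ℝ (Fin D)))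

/-- The set of points of `ℝ^D` that have a unique nearest point in `M`. -/
def uniqueNearest {D : ℕ} (M : Set (EuclideanSpace ℝ (Fin D))) :
    Set (EuclideanSpace ℝ (Fin D)) :=
  {y | ∃! x, x ∈ M ∧ dist y x = Metric.infDist y M}

/-- The reach of `M`: the supremum of all `r ≥ 0` such that every point at distance less than `r`
from `M` has a unique nearest point in `M`. -/
noncomputable def reach {D : ℕ} (M : Set (EuclideanSpace ℝ (Fin D))) : ℝ≥0∞ :=
  ⨆ (r : ℝ≥0) (_ : Metric.thickening (r : ℝ) M ⊆ uniqueNearest M), (r : ℝ≥0∞)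

/-- The tube `M_σ`: the points at distance less than `σ` from `M`. For `σ = 0` (the noiseless
case) it is `M` itself. -/
noncomputable def tube {D : ℕ} (M : Set (EuclideanSpace ℝ (Fin D))) (σ : ℝ) :
    Set (EuclideanSpace ℝ (Fin D)) :=
  if σ = 0 then M else Metric.thickening σ M

/-- The uniform distribution on the tube `M_σ` around a `d`-dimensional `M`: normalized Lebesgue
measure for `σ > 0`, and normalized `d`-dimensional Hausdorff measure (Riemannian volume) of `M`
for `σ = 0`. -/
noncomputable def uniformTube {D : ℕ} (d : ℕ) (M : Set (EuclideanSpace ℝ (Fin D))) (σ : ℝ) :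
    Measure (EuclideanSpace ℝ (Fin D)) :=
  ProbabilityTheory.cond (if σ = 0 then Measure.hausdorffMeasure (d : ℝ) else volume) (tube M σ)

/-- The covariance matrix of a random vector. -/
noncomputable def covMatrix {Ω : Type*} [MeasurableSpace Ω] {D : ℕ}
    (P : Measure Ω) (Z : Ω → EuclideanSpace ℝ (Fin D)) : Matrix (Fin D) (Fin D) ℝ :=
  Matrix.of fun i j => covariance (fun ω => Z ω i) (fun ω => Z ω j) P

theorem covMatrix_isHermitian {Ω : Type*} [MeasurableSpace Ω] {D : ℕ}
    (P : Measure Ω) (Z : Ω → EuclideanSpace ℝ (Fin D)) : (covMatrix P Z).IsHermitian := by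
  ext i j
  simp [covMatrix, covariance_comm]

/-- The `k`-th largest eigenvalue (`1 ≤ k ≤ D`, counted with multiplicity) of the covariance
matrix of a random vector. -/
noncomputable def covEigenvalue {Ω : Type*} [MeasurableSpace Ω] {D : ℕ}
    (P : Measure Ω) (Z : Ω → EuclideanSpace ℝ (Fin D)) (k : ℕ) (hk : 1 ≤ k) (hkD : k ≤ D) : ℝ :=
  (covMatrix_isHermitian P Z).eigenvalues₀ ⟨k - 1, by rw [Fintype.card_fin]; omega⟩

/-- `V` is a subspace of the first `d` principal components of `Z`: a `d`-dimensional linear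
subspace minimizing `𝔼 ‖Z - 𝔼Z - Proj_V (Z - 𝔼Z)‖²` among all `d`-dimensional subspaces. -/
def IsPrincipalSubspace {Ω : Type*} [MeasurableSpace Ω] {D : ℕ}
    (P : Measure Ω) (Z : Ω → EuclideanSpace ℝ (Fin D)) (d : ℕ)
    (V : Submodule ℝ (EuclideanSpace ℝ (Fin D))) : Prop :=
  Module.finrank ℝ V = d ∧
    ∀ W : Submodule ℝ (EuclideanSpace ℝ (Fin D)), Module.finrank ℝ W = d →
      ∫ ω, ‖Z ω - (∫ ω', Z ω' ∂P) - V.starProjection (Z ω - ∫ ω', Z ω' ∂P)‖ ^ 2 ∂P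
        ≤ ∫ ω, ‖Z ω - (∫ ω', Z ω' ∂P) - W.starProjection (Z ω - ∫ ω', Z ω' ∂P)‖ ^ 2 ∂P

/-- The constant `γ(σ, τ, d, r₁, r₂)`. -/
noncomputable def gammaConst (σ τ : ℝ) (d : ℕ) (r₁ r₂ : ℝ) : ℝ :=
  4 * √(2 * d) * (1 + σ / τ) ^ ((d : ℝ) / 2) * ((r₂ + σ) / (r₁ - σ)) ^ ((d : ℝ) / 2) *
    ((1 + (2 * (r₂ + σ) / (τ - 2 * (r₂ + σ))) ^ 2) /
      (1 - ((r₁ - σ) / (2 * τ)) ^ 2)) ^ ((d : ℝ) / 4)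

/-! The reach enters through uniqueness of nearest points at distance less than τ. It yields
Federer's inequality `2τ⟪z - m, n⟫ ≤ ‖n‖ ‖z - m‖²` for `m, z ∈ M` and `n` normal at `m`
(`IsTangentField.inner_le_of_unique_nearest`): open balls of radius τ touching `M` from a normal
direction miss `M`. A counterpart, that `m + w` with `w` tangent at `m` lies within `‖w‖² / (2τ)` of
`M`, follows from a differential inequality (`IsTangentField.infDist_le`). These two facts, bundled
in `HasReachGeometry` with the normality of segments to nearest points, control chords, tangent
spaces and projections near `y`.

Eigenvalue. By Courant–Fischer (`le_covEigenvalue`) it suffices to bound the variance of `Z` from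
below in every direction of the tangent space `T y`. The law of `Z`, projected orthogonally to `T
y`, dominates a multiple of Lebesgue measure on a ball of radius `ρ = s √(1 - (s / 2τ)²)` with `s =
r₁ - σ`: the part of `M` near `y` projects onto this ball (`exists_starProjection_eq`), and over
each of its points the tube contains a normal ball of radius σ. The total mass is bounded by the
volume of the tube over `M ∩ closedBall y (r₂ + σ)`, which exceeds the product volume at most by `(1
+ σ/τ)^d` (`volume_tube_le`), while this piece of `M` is a Lipschitz graph over `T y`. The volume of
the normal ball cancels in the quotient, and the second moment of a Euclidean ball gives the bound;
the stated constant is slightly weaker.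

Principal components. Points of the tube in `Q` lie within `σ + 2r₂²/τ` of `y + T y`. So `T y`, and
by minimality also `V`, has mean squared residual at most `e = 2σ² + 8r₂⁴/τ²`. Since `Z` has
variance at least `l` in all directions of `T y`, small residuals for both subspaces force `T y` to
be close to `V` (`mul_norm_sub_starProjection_sq_le`). Splitting `x - 𝔼Z` into its parts normal and
tangent at `y` finishes the proof. -/

section TubeCovariance

open Metric Set Filter Topology Asymptotics
open scoped InnerProductSpace

/-! ### Tangent spaces of a C² submanifold -/

/-- Taylor's inequality of order two at a point, for a `C²` map between normed spaces. -/
theorem exists_norm_sub_sub_fderiv_le_of_contDiffAt {E F : Type*} [NormedAddCommGroup E]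
    [NormedSpace ℝ E] [NormedAddCommGroup F] [NormedSpace ℝ F] {f : E → F} {x : E}
    (hf : ContDiffAt ℝ 2 f x) :
    ∃ C : ℝ, 0 ≤ C ∧ ∀ᶠ y in 𝓝 x, ‖f y - f x - fderiv ℝ f x (y - x)‖ ≤ C * ‖y - x‖ ^ 2 := by
  obtain ⟨K, s, hs, hK⟩ := (hf.fderiv_right (m := 1) (by norm_num)).exists_lipschitzOnWith
  have hd : ∀ᶠ y in 𝓝 x, DifferentiableAt ℝ f y :=
    (hf.eventually (by simp)).mono fun y hy => hy.differentiableAt (by simp)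
  obtain ⟨ε, hε, hball⟩ := Metric.eventually_nhds_iff_ball.1 (hd.and hs)
  refine ⟨K, K.2, Metric.eventually_nhds_iff_ball.2 ⟨ε, hε, fun y hy => ?_⟩⟩
  have hsub : closedBall x (dist y x) ⊆ ball x ε := closedBall_subset_ball hy
  have := Convex.norm_image_sub_le_of_norm_fderiv_le' (𝕜 := ℝ) (f := f)
    (s := closedBall x (dist y x)) (C := K * ‖y - x‖) (φ := fderiv ℝ f x) (x := x) (y := y)
    (fun z hz => (hball z (hsub hz)).1) (fun z hz => ?_) (convex_closedBall _ _)
    (mem_closedBall_self dist_nonneg) (mem_closedBall.2 le_rfl)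
  · calc _ ≤ _ := this
      _ = _ := by ring
  · have h1 := hK.dist_le_mul z (hball z (hsub hz)).2 x (mem_of_mem_nhds hs)
    rw [dist_eq_norm] at h1
    refine h1.trans (mul_le_mul_of_nonneg_left ?_ K.2)
    rw [← dist_eq_norm]
    exact hz

/-- `T` assigns to the points of `M` linear subspaces which are tangent to `M` to first order,
and whose orthogonal complements are normal to `M` to second order. -/
structure IsTangentField {E : Type*} [NormedAddCommGroup E] [InnerProductSpace ℝ E]
    (M : Set E) (T : E → Submodule ℝ E) : Prop where
  infDist_isLittleO : ∀ m ∈ M, ∀ w ∈ T m,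
    (fun t : ℝ => infDist (m + t • w) M) =o[𝓝 0] (fun t => t)
  inner_le : ∀ m ∈ M, ∀ n ∈ (T m)ᗮ, ∃ C : ℝ, ∀ z ∈ M, ⟪z - m, n⟫_ℝ ≤ C * ‖z - m‖ ^ 2

/-- The tangent space is the image of `L` under the derivative `A` of the inverse chart. The curves
`φ.symm (φ p + t • v)` in `M` have velocity `A v`, and by Taylor's inequality `z - p` differs from
the tangent vector `A (φ z - φ p)` only to second order. -/
theorem IsC2Submanifold.exists_tangentSpace {D d : ℕ} {M : Set (EuclideanSpace ℝ (Fin D))}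
    (hM : IsC2Submanifold d M) {p : EuclideanSpace ℝ (Fin D)} (hp : p ∈ M) :
    ∃ T : Submodule ℝ (EuclideanSpace ℝ (Fin D)), Module.finrank ℝ T = d ∧
      (∀ w ∈ T, (fun t : ℝ => infDist (p + t • w) M) =o[𝓝 0] (fun t => t)) ∧
      ∀ n ∈ Tᗮ, ∃ C : ℝ, ∀ z ∈ M, ⟪z - p, n⟫_ℝ ≤ C * ‖z - p‖ ^ 2 := by
  obtain ⟨φ, L, hps, hL, hφ, hψ, hφM⟩ := hM p hp
  have hφc : ContDiffAt ℝ 2 φ p := hφ.contDiffAt (φ.open_source.mem_nhds hps)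
  have hpt : φ p ∈ φ.target := φ.map_source hps
  have hψc : ContDiffAt ℝ 2 φ.symm (φ p) := hψ.contDiffAt (φ.open_target.mem_nhds hpt)
  have hpL : φ p ∈ L := by
    have : p ∈ φ.source ∩ M := ⟨hps, hp⟩
    rw [hφM] at this
    exact this.2
  set A := fderiv ℝ φ.symm (φ p) with hA
  have hψd : HasFDerivAt φ.symm A (φ p) := (hψc.differentiableAt (by simp)).hasFDerivAt
  have hφd : HasFDerivAt φ (fderiv ℝ φ p) p := (hφc.differentiableAt (by simp)).hasFDerivAt
  have hAinj : Function.Injective A := by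
    have h1 : HasFDerivAt (φ ∘ φ.symm) ((fderiv ℝ φ p).comp A) (φ p) := by
      refine HasFDerivAt.comp (φ p) ?_ hψd
      rwa [φ.left_inv hps]
    have h2 : HasFDerivAt (φ ∘ φ.symm) (ContinuousLinearMap.id ℝ _) (φ p) :=
      (hasFDerivAt_id (φ p)).congr_of_eventuallyEq
        (Filter.eventuallyEq_of_mem (φ.open_target.mem_nhds hpt) fun x hx => φ.right_inv hx)
    have h3 := h1.unique h2
    intro a b hab
    have := congrArg (fun B => B a) h3
    have h' := congrArg (fun B => B b) h3
    simp only [ContinuousLinearMap.comp_apply, ContinuousLinearMap.id_apply] at this h'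
    rw [← this, ← h', hab]
  have hmem : ∀ x ∈ φ.target, x ∈ L → φ.symm x ∈ M := by
    intro x hx hxL
    have : φ.symm x ∈ φ.source ∩ φ ⁻¹' (L : Set (EuclideanSpace ℝ (Fin D))) :=
      ⟨φ.map_target hx, by simpa [φ.right_inv hx] using hxL⟩
    rw [← hφM] at this
    exact this.2
  refine ⟨L.map (A : EuclideanSpace ℝ (Fin D) →ₗ[ℝ] EuclideanSpace ℝ (Fin D)), ?_, ?_, ?_⟩
  · rw [← hL]
    exact (Submodule.equivMapOfInjective (A : EuclideanSpace ℝ (Fin D) →ₗ[ℝ] EuclideanSpace ℝ (Fin D))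
      hAinj L).finrank_eq.symm
  · rintro _ ⟨v, hv, rfl⟩
    have hline : HasDerivAt (fun t : ℝ => φ p + t • v) v 0 := by
      simpa using ((hasDerivAt_id (0 : ℝ)).smul_const v).const_add (φ p)
    have hc : HasDerivAt (fun t : ℝ => φ.symm (φ p + t • v)) (A v) 0 := by
      refine HasFDerivAt.comp_hasDerivAt (x := (0 : ℝ)) (f := fun t : ℝ => φ p + t • v) ?_ hline
      simpa using hψd
    have ho := hasDerivAt_iff_isLittleO.1 hc
    simp only [zero_smul, add_zero, sub_zero, φ.left_inv hps] at ho
    refine IsBigO.trans_isLittleO (IsBigO.of_bound 1 ?_) ho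
    have hev : ∀ᶠ t : ℝ in 𝓝 0, φ p + t • v ∈ φ.target := by
      refine hline.continuousAt.eventually_mem (φ.open_target.mem_nhds ?_)
      simpa using hpt
    filter_upwards [hev] with t ht
    rw [Real.norm_of_nonneg infDist_nonneg, one_mul, norm_sub_rev]
    refine (infDist_le_dist_of_mem (hmem _ ht (L.add_mem hpL (L.smul_mem t hv)))).trans ?_
    rw [dist_eq_norm, norm_sub_rev, ← norm_neg]
    apply le_of_eq
    congr 1
    simp only [ContinuousLinearMap.coe_coe]
    abel
  · intro n hn
    obtain ⟨C, hC0, hC⟩ := exists_norm_sub_sub_fderiv_le_of_contDiffAt hψc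
    obtain ⟨K, s, hs, hK⟩ := (hφc.of_le (by norm_num : (1 : WithTop ℕ∞) ≤ 2)).exists_lipschitzOnWith
    have hev : ∀ᶠ z in 𝓝 p, z ∈ φ.source ∧ z ∈ s ∧
        ‖φ.symm (φ z) - φ.symm (φ p) - A (φ z - φ p)‖ ≤ C * ‖φ z - φ p‖ ^ 2 :=
      (φ.open_source.eventually_mem hps).and
        (Filter.Eventually.and hs (hφc.continuousAt.eventually hC))
    obtain ⟨δ, hδ, hball⟩ := Metric.eventually_nhds_iff_ball.1 hev
    -- The first constant serves the points in the chart near `p`; the second serves all others, for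
    -- which `δ ≤ ‖z - p‖` and Cauchy–Schwarz is enough.
    refine ⟨max (C * K ^ 2 * ‖n‖) (‖n‖ / δ), fun z hz => ?_⟩
    by_cases hzδ : z ∈ ball p δ
    · obtain ⟨h1, h2, h3⟩ := hball z hzδ
      have hzL : φ z ∈ L := by
        have : z ∈ φ.source ∩ M := ⟨h1, hz⟩
        rw [hφM] at this
        exact this.2
      have hort : ⟪A (φ z - φ p), n⟫_ℝ = 0 :=
        (Submodule.mem_orthogonal _ _).1 hn _ (Submodule.mem_map_of_mem (L.sub_mem hzL hpL))
      rw [φ.left_inv h1, φ.left_inv hps] at h3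
      have hK' : ‖φ z - φ p‖ ≤ K * ‖z - p‖ := by
        simpa [dist_eq_norm] using hK.dist_le_mul z h2 p (mem_of_mem_nhds hs)
      calc ⟪z - p, n⟫_ℝ = ⟪z - p - A (φ z - φ p), n⟫_ℝ := by 
            rw [inner_sub_left (z - p), hort, sub_zero]
        _ ≤ ‖z - p - A (φ z - φ p)‖ * ‖n‖ := real_inner_le_norm _ _
        _ ≤ (C * (K * ‖z - p‖) ^ 2) * ‖n‖ := by
            refine mul_le_mul_of_nonneg_right (h3.trans ?_) (norm_nonneg _)
            gcongr
        _ = (C * K ^ 2 * ‖n‖) * ‖z - p‖ ^ 2 := by ring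
        _ ≤ _ := by gcongr; exact le_max_left _ _
    · have hd : δ ≤ ‖z - p‖ := by simpa [dist_eq_norm] using hzδ
      calc ⟪z - p, n⟫_ℝ ≤ ‖z - p‖ * ‖n‖ := real_inner_le_norm _ _
        _ = (‖n‖ / δ) * (δ * ‖z - p‖) := by field_simp
        _ ≤ (‖n‖ / δ) * (‖z - p‖ * ‖z - p‖) := by gcongr
        _ = (‖n‖ / δ) * ‖z - p‖ ^ 2 := by ring
        _ ≤ _ := by gcongr; exact le_max_right _ _

theorem IsC2Submanifold.exists_isTangentField {D d : ℕ} {M : Set (EuclideanSpace ℝ (Fin D))}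
    (hM : IsC2Submanifold d M) :
    ∃ T : EuclideanSpace ℝ (Fin D) → Submodule ℝ (EuclideanSpace ℝ (Fin D)),
      IsTangentField M T ∧ ∀ m ∈ M, Module.finrank ℝ (T m) = d := by
  have h : ∀ p, ∃ T : Submodule ℝ (EuclideanSpace ℝ (Fin D)), p ∈ M →
      Module.finrank ℝ T = d ∧
      (∀ w ∈ T, (fun t : ℝ => infDist (p + t • w) M) =o[𝓝 0] (fun t => t)) ∧
      ∀ n ∈ Tᗮ, ∃ C : ℝ, ∀ z ∈ M, ⟪z - p, n⟫_ℝ ≤ C * ‖z - p‖ ^ 2 := by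
    intro p
    by_cases hp : p ∈ M
    · obtain ⟨T, hT⟩ := hM.exists_tangentSpace hp
      exact ⟨T, fun _ => hT⟩
    · exact ⟨⊥, fun h => absurd h hp⟩
  choose T hT using h
  exact ⟨T, ⟨fun m hm => (hT m hm).2.1, fun m hm => (hT m hm).2.2⟩, fun m hm => (hT m hm).1⟩

/-! ### Nearest points and growth of the distance function -/

section NearestPoint

/-- Nearest points depend continuously on the point, where they are unique. -/
theorem IsCompact.exists_forall_dist_nearest_lt {E : Type*} [MetricSpace E] {M : Set E}
    (hM : IsCompact M) {x m : E}
    (hu : ∀ z ∈ M, dist x z = infDist x M → z = m) {ε : ℝ} (hε : 0 < ε) :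
    ∃ δ > 0, ∀ x' m', dist x' x < δ → m' ∈ M → dist x' m' = infDist x' M → dist m' m < ε := by
  rcases (M \ ball m ε).eq_empty_or_nonempty with hK | hK
  · refine ⟨1, one_pos, fun x' m' _ hm' _ => ?_⟩
    by_contra h
    exact (hK ▸ notMem_empty m') ⟨hm', h⟩
  · obtain ⟨k, hk, hkd⟩ := (hM.diff isOpen_ball).exists_infDist_eq_dist hK x
    have hlt : infDist x M < dist x k := by
      refine lt_of_le_of_ne (infDist_le_dist_of_mem hk.1) fun h => hk.2 ?_
      rw [hu k hk.1 h.symm]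
      exact mem_ball_self hε
    -- Half of the gap between the nearest point and the rest of `M`: moving `x` by less than this
    -- changes each of the two distances by less than half the gap.
    refine ⟨(dist x k - infDist x M) / 2, by linarith, fun x' m' hx' hm' hd => ?_⟩
    by_contra h
    have h1 : dist x k ≤ dist x m' := hkd ▸ infDist_le_dist_of_mem ⟨hm', h⟩
    have h2 : infDist x' M ≤ infDist x M + dist x' x := infDist_le_infDist_add_dist
    have h3 := dist_triangle x x' m'
    rw [dist_comm x x'] at h3
    linarith

variable {E : Type*} [NormedAddCommGroup E] [InnerProductSpace ℝ E] [FiniteDimensional ℝ E]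
  {M : Set E} {τ : ℝ}

/-- The distance to `M` grows at almost unit speed up to any distance less than `τ`. -/
theorem exists_dist_le_add_mul_le_infDist (hM : IsCompact M) (hne : M.Nonempty)
    (hU : ∀ x, infDist x M < τ → ∃! m, m ∈ M ∧ dist x m = infDist x M) {x₀ : E}
    (h₀ : 0 < infDist x₀ M) {s : ℝ} (hs : 0 ≤ s) (hsτ : infDist x₀ M + s < τ) {η : ℝ} (hη : 0 < η)
    (hη1 : η < 1) : ∃ x, dist x x₀ ≤ s ∧ infDist x₀ M + (1 - η) * s ≤ infDist x M := by
  -- Maximize the distance to `M` among the points of the ball reached at speed at least `1 - η`. A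
  -- maximizer inside the ball could be pushed further away from its nearest point, so it lies on
  -- the sphere of radius `s`.
  have hScl : IsClosed {x | infDist x₀ M + (1 - η) * dist x x₀ ≤ infDist x M} :=
    isClosed_le (by fun_prop) (continuous_infDist_pt M)
  have hScp := (isCompact_closedBall x₀ s).inter_right hScl
  obtain ⟨x, ⟨hxb, hx⟩, hmax⟩ := hScp.exists_isMaxOn
    ⟨x₀, mem_closedBall_self hs, by simp⟩ (continuous_infDist_pt M).continuousOn
  rw [mem_closedBall] at hxb
  simp only [mem_ofPred_eq] at hx
  refine ⟨x, hxb, ?_⟩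
  rcases hxb.eq_or_lt with h | hlt
  · rwa [h] at hx
  exfalso
  have hx0 : 0 < infDist x M := by
    nlinarith [mul_nonneg (sub_nonneg.2 hη1.le) (dist_nonneg (x := x) (y := x₀))]
  have hxτ : infDist x M < τ := by
    have : infDist x M ≤ infDist x₀ M + dist x x₀ := infDist_le_infDist_add_dist
    linarith
  obtain ⟨m, ⟨hm, hxm⟩, huniq⟩ := hU x hxτ
  obtain ⟨δ, hδ, hδm⟩ := hM.exists_forall_dist_nearest_lt (x := x) (m := m)
    (fun z hz hzd => huniq z ⟨hz, hzd⟩) (ε := η * infDist x M) (by positivity)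
  set a := infDist x M with ha
  set ν : E := a⁻¹ • (x - m) with hν
  have hna : ‖x - m‖ = a := by rw [← dist_eq_norm, hxm]
  have hνn : ‖ν‖ = 1 := by
    rw [hν, norm_smul, norm_inv, Real.norm_of_nonneg hx0.le, hna, inv_mul_cancel₀ hx0.ne']
  obtain ⟨h, hh0, hhδ, hhs⟩ : ∃ h > 0, h < δ ∧ h < s - dist x x₀ := by
    obtain ⟨h, h1, h2⟩ := exists_between (lt_min hδ (sub_pos.2 hlt))
    exact ⟨h, h1, (lt_min_iff.1 h2).1, (lt_min_iff.1 h2).2⟩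
  have hdx : dist (x + h • ν) x = h := by
    rw [dist_eq_norm, add_sub_cancel_left, norm_smul, hνn, mul_one, Real.norm_of_nonneg hh0.le]
  obtain ⟨m', hm', hm'd⟩ := hM.exists_infDist_eq_dist hne (x + h • ν)
  have hmm := hδm (x + h • ν) m' (by rw [hdx]; exact hhδ) hm' hm'd.symm
  -- The nearest point has moved by less than `η a`, so the squared distance is at least `a² + 2(1 -
  -- η)ah + h²`.
  have hgrow : a + (1 - η) * h ≤ infDist (x + h • ν) M := by
    rw [hm'd, dist_eq_norm]
    refine le_of_sq_le_sq ?_ (norm_nonneg _)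
    have e1 : x + h • ν - m' = (x - m') + h • ν := by abel
    have e2 : ⟪x - m', ν⟫_ℝ = a + ⟪m - m', ν⟫_ℝ := by
      have : x - m' = (x - m) + (m - m') := by abel
      rw [this, inner_add_left, hν, inner_smul_right, real_inner_self_eq_norm_sq, hna]
      field_simp
    have e3 : -(η * a) ≤ ⟪m - m', ν⟫_ℝ := by
      have h1 := abs_real_inner_le_norm (m - m') ν
      rw [hνn, mul_one, ← dist_eq_norm, dist_comm] at h1
      have h2 := (abs_le.1 h1).1
      linarith
    have e4 : a ≤ ‖x - m'‖ := by
      rw [← dist_eq_norm]; exact infDist_le_dist_of_mem hm'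
    have e5 : a ^ 2 ≤ ‖x - m'‖ ^ 2 := by gcongr
    rw [e1, norm_add_sq_real, inner_smul_right, e2, norm_smul, hνn, mul_one,
      Real.norm_of_nonneg hh0.le]
    nlinarith [mul_nonneg hη.le hh0.le, mul_pos hh0 hh0, mul_nonneg hh0.le (by linarith : 0 ≤ ⟪m - m', ν⟫_ℝ + η * a),
      mul_nonneg (mul_nonneg hη.le (sub_nonneg.2 hη1.le)) (mul_pos hh0 hh0).le,
      mul_nonneg hη.le (mul_pos hh0 hh0).le]
  have hdx0 : dist (x + h • ν) x₀ ≤ dist x x₀ + h := by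
    have := dist_triangle (x + h • ν) x x₀
    linarith
  have hin : x + h • ν ∈ closedBall x₀ s ∩ {x | infDist x₀ M + (1 - η) * dist x x₀ ≤ infDist x M} := by
    refine ⟨mem_closedBall.2 (by linarith), ?_⟩
    simp only [mem_ofPred_eq]
    nlinarith [mul_le_mul_of_nonneg_left hdx0 (sub_nonneg.2 hη1.le)]
  have hle : infDist (x + h • ν) M ≤ infDist x M := hmax hin
  nlinarith [mul_pos (sub_pos.2 hη1) hh0]

/-- A nearest point of `x` remains a nearest point when `x` moves away from it along the normal
ray, up to any distance less than `τ`. -/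
theorem infDist_add_smul_of_infDist (hM : IsCompact M)
    (hU : ∀ x, infDist x M < τ → ∃! m, m ∈ M ∧ dist x m = infDist x M) {m n : E} (hm : m ∈ M)
    (hn : ‖n‖ = 1) {t₀ t : ℝ} (ht₀ : 0 < t₀) (h : infDist (m + t₀ • n) M = t₀) (ht : t₀ ≤ t)
    (htτ : t < τ) : infDist (m + t • n) M = t := by
  set x₀ := m + t₀ • n with hx₀
  obtain ⟨x, hx, hmax⟩ := (isCompact_closedBall x₀ (t - t₀)).exists_isMaxOn
    ⟨x₀, mem_closedBall_self (sub_nonneg.2 ht)⟩ (continuous_infDist_pt M).continuousOn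
  -- Let `η` tend to zero in the growth estimate, using that `x` maximizes the distance over the
  -- whole ball.
  have hle : t ≤ infDist x M := by
    refine le_of_forall_pos_lt_add fun ε hε => ?_
    obtain ⟨η, hη, hη2⟩ := exists_between
      (lt_min (one_half_pos (α := ℝ)) (div_pos hε (by linarith : 0 < t - t₀ + 1)))
    obtain ⟨x', hx', hd⟩ := exists_dist_le_add_mul_le_infDist hM ⟨m, hm⟩ hU (x₀ := x₀)
      (by rw [h]; exact ht₀) (sub_nonneg.2 ht) (by rw [h]; linarith) hη
      (by linarith [(lt_min_iff.1 hη2).1])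
    have h1 : infDist x' M ≤ infDist x M := hmax (mem_closedBall.2 hx')
    have h2 : η * (t - t₀ + 1) < ε := (lt_div_iff₀ (by linarith)).1 (lt_min_iff.1 hη2).2
    rw [h] at hd
    nlinarith
  have hxm : t ≤ ‖x - m‖ := by
    rw [← dist_eq_norm]; exact hle.trans (infDist_le_dist_of_mem hm)
  have ha : ‖x - x₀‖ ≤ t - t₀ := by rw [← dist_eq_norm]; exact hx
  -- Equality case of the triangle inequality for `m`, `x₀`, `x`: the lengths `t₀` and at most `t -
  -- t₀` add up to at least `t`.
  have hxe : x = m + t • n := by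
    have e1 : x - m = (x - x₀) + t₀ • n := by rw [hx₀]; abel
    have e2 : x - (m + t • n) = (x - x₀) - (t - t₀) • n := by rw [hx₀, sub_smul]; abel
    have h1 : t ^ 2 ≤ ‖x - m‖ ^ 2 := by gcongr; linarith
    rw [e1, norm_add_sq_real, inner_smul_right, norm_smul, hn, Real.norm_of_nonneg ht₀.le] at h1
    have h2 : ‖x - x₀‖ ^ 2 ≤ (t - t₀) ^ 2 := by gcongr
    have h3 : ‖x - (m + t • n)‖ ^ 2 * t₀ ≤ 0 := by
      rw [e2, norm_sub_sq_real, inner_smul_right, norm_smul, hn,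
        Real.norm_of_nonneg (sub_nonneg.2 ht)]
      nlinarith [mul_le_mul_of_nonneg_left h1 (sub_nonneg.2 ht),
        mul_le_mul_of_nonneg_left h2 (ht₀.le.trans ht)]
    have h4 : ‖x - (m + t • n)‖ ^ 2 ≤ 0 := by
      by_contra hc
      push Not at hc
      nlinarith [mul_pos hc ht₀]
    rw [← sub_eq_zero, ← norm_eq_zero]
    exact pow_eq_zero_iff (two_ne_zero) |>.1 (le_antisymm h4 (sq_nonneg _))
  refine le_antisymm ?_ (hxe ▸ hle)
  refine (infDist_le_dist_of_mem hm).trans ?_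
  rw [dist_eq_norm, add_sub_cancel_left, norm_smul, hn, mul_one, Real.norm_of_nonneg]
  linarith

end NearestPoint

/-! ### Federer's inequality and normality of nearest-point segments -/

section TangentField

variable {E : Type*} [NormedAddCommGroup E] [InnerProductSpace ℝ E] {M : Set E} {τ : ℝ}
  {T : E → Submodule ℝ E}

/-- The open balls of radius `τ` which touch `M` from a normal direction do not meet `M`. -/
theorem IsTangentField.inner_le_of_unique_nearest [FiniteDimensional ℝ E]
    (hT : IsTangentField M T) (hM : IsCompact M)
    (hτ : 0 < τ) (hU : ∀ x, infDist x M < τ → ∃! m, m ∈ M ∧ dist x m = infDist x M)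
    {m : E} (hm : m ∈ M) {n : E} (hn : n ∈ (T m)ᗮ) {z : E} (hz : z ∈ M) :
    2 * τ * ⟪z - m, n⟫_ℝ ≤ ‖n‖ * ‖z - m‖ ^ 2 := by
  suffices hunit : ∀ n ∈ (T m)ᗮ, ‖n‖ = 1 → 2 * τ * ⟪z - m, n⟫_ℝ ≤ ‖z - m‖ ^ 2 by
    rcases eq_or_ne n 0 with rfl | hn0
    · simp
    have hpos : 0 < ‖n‖ := norm_pos_iff.2 hn0
    have := hunit (‖n‖⁻¹ • n) ((T m)ᗮ.smul_mem _ hn)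
      (by rw [norm_smul, norm_inv, norm_norm, inv_mul_cancel₀ hpos.ne'])
    rw [inner_smul_right] at this
    calc 2 * τ * ⟪z - m, n⟫_ℝ = ‖n‖ * (2 * τ * (‖n‖⁻¹ * ⟪z - m, n⟫_ℝ)) := by field_simp
      _ ≤ _ := by gcongr
  clear hn n
  intro n hn hn1
  obtain ⟨C, hC⟩ := hT.inner_le m hm n hn
  have key : ∀ (t : ℝ) (z : E), 0 ≤ t → 
      (t ≤ dist (m + t • n) z ↔ 2 * t * ⟪z - m, n⟫_ℝ ≤ ‖z - m‖ ^ 2) := by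
    intro t z ht
    have e : ‖m + t • n - z‖ ^ 2 = ‖z - m‖ ^ 2 - 2 * t * ⟪z - m, n⟫_ℝ + t ^ 2 := by
      have : m + t • n - z = t • n - (z - m) := by abel
      rw [this, norm_sub_sq_real, inner_smul_left, norm_smul, hn1, real_inner_comm,
        Real.norm_of_nonneg ht]
      simp
      ring
    rw [dist_eq_norm, ← sq_le_sq₀ ht (norm_nonneg _), e]
    constructor <;> intro h <;> linarith
  have hself : ∀ t : ℝ, 0 ≤ t → dist (m + t • n) m = t := by
    intro t ht
    rw [dist_eq_norm, add_sub_cancel_left, norm_smul, hn1, mul_one, Real.norm_of_nonneg ht]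
  -- The second-order bound at `m` makes normal balls of the small radius `t₀` miss `M`. The ray
  -- lemma enlarges the radius to any value below `τ`, and a closure argument reaches `τ`.
  obtain ⟨t₀, ht₀, ht₀'⟩ := exists_between
    (lt_min hτ (by positivity : 0 < 1 / (2 * (|C| + 1))))
  have hC0 : 2 * t₀ * C ≤ 1 := by
    have h1 : t₀ * (2 * (|C| + 1)) < 1 := by
      have := (lt_min_iff.1 ht₀').2
      rwa [lt_div_iff₀ (by positivity)] at this
    nlinarith [le_abs_self C]
  have hinf₀ : infDist (m + t₀ • n) M = t₀ := by
    refine le_antisymm ((infDist_le_dist_of_mem hm).trans_eq (hself t₀ ht₀.le)) ?_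
    rw [le_infDist ⟨m, hm⟩]
    intro z hz
    rw [key t₀ z ht₀.le]
    nlinarith [hC z hz, sq_nonneg ‖z - m‖]
  have hlt : ∀ t ∈ Ico t₀ τ, 2 * t * ⟪z - m, n⟫_ℝ ≤ ‖z - m‖ ^ 2 := by
    intro t ht
    rw [← key t z (ht₀.le.trans ht.1)]
    have := infDist_add_smul_of_infDist hM hU hm hn1 ht₀ hinf₀ ht.1 ht.2
    exact this.symm.trans_le (infDist_le_dist_of_mem hz)
  have hcl : IsClosed {t : ℝ | 2 * t * ⟪z - m, n⟫_ℝ ≤ ‖z - m‖ ^ 2} :=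
    isClosed_le (by fun_prop) (by fun_prop)
  have := closure_minimal hlt hcl
  rw [closure_Ico (lt_min_iff.1 ht₀').1.ne] at this
  exact this ⟨(lt_min_iff.1 ht₀').1.le, le_rfl⟩

/-- If `x - m` had a positive component along a tangent vector `w`, moving from `m` along `w` would
shorten the distance to `x` at linear rate `c / a`, whereas the distance from `m + t • w` to `M` is
only `o(t)`. Half of the rate is spent on that error. -/
theorem IsTangentField.sub_mem_orthogonal (hT : IsTangentField M T) {x m : E} (hm : m ∈ M)
    (hx : dist x m = infDist x M) : x - m ∈ (T m)ᗮ := by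
  suffices h : ∀ w ∈ T m, ⟪w, x - m⟫_ℝ ≤ 0 by
    rw [Submodule.mem_orthogonal]
    intro w hw
    refine le_antisymm (h w hw) ?_
    have := h (-w) ((T m).neg_mem hw)
    rw [inner_neg_left] at this
    linarith
  intro w hw
  by_contra! hc
  set c := ⟪w, x - m⟫_ℝ with hcdef
  set a := ‖x - m‖ with ha
  have ha0 : 0 < a := by
    rw [ha, norm_pos_iff]
    rintro h
    rw [hcdef, h, inner_zero_right] at hc
    exact lt_irrefl _ hc
  have hε : 0 < c / (2 * a) := by positivity
  have hev := (isLittleO_iff.1 (hT.infDist_isLittleO m hm w hw)) hε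
  obtain ⟨δ, hδ, hball⟩ := Metric.eventually_nhds_iff_ball.1 hev
  obtain ⟨t, ht0, ht⟩ := exists_between
    (lt_min hδ (lt_min (div_pos hc (by positivity : 0 < ‖w‖ ^ 2 + 1)) (div_pos ha0 hε)))
  obtain ⟨ht1, ht2, ht3⟩ := lt_min_iff.1 ht |>.imp_right lt_min_iff.1
  have h1 := hball t (by simpa [abs_of_pos ht0] using ht1)
  rw [Real.norm_of_nonneg infDist_nonneg, Real.norm_of_nonneg ht0.le] at h1
  have h2 : a ≤ ‖x - m - t • w‖ + c / (2 * a) * t := by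
    have h3 : infDist x M ≤ infDist (m + t • w) M + dist x (m + t • w) :=
      infDist_le_infDist_add_dist
    rw [← hx, dist_eq_norm, dist_eq_norm, ← sub_sub] at h3
    linarith
  rw [lt_div_iff₀ (by positivity)] at ht2 ht3
  have h4 : (a - c / (2 * a) * t) ^ 2 ≤ ‖x - m - t • w‖ ^ 2 :=
    pow_le_pow_left₀ (by linarith) (by linarith) 2
  rw [norm_sub_sq_real, inner_smul_right, real_inner_comm, ← hcdef, norm_smul,
    Real.norm_of_nonneg ht0.le] at h4
  have h5 : a * (c / (2 * a) * t) = c * t / 2 := by field_simp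
  nlinarith [sq_nonneg (c / (2 * a) * t), sq_nonneg t, mul_pos ht0 hc]

end TangentField

/-- The geometry of a set `M` of reach at least `τ` with tangent spaces `T m`: the normal balls of
radius `τ` do not meet `M`, tangent vectors are close to `M`, and segments to nearest points are
normal. -/
structure HasReachGeometry {E : Type*} [NormedAddCommGroup E] [InnerProductSpace ℝ E]
    (M : Set E) (τ : ℝ) (T : E → Submodule ℝ E) : Prop where
  isCompact : IsCompact M
  pos : 0 < τ
  inner_le : ∀ m ∈ M, ∀ n ∈ (T m)ᗮ, ∀ z ∈ M, 2 * τ * ⟪z - m, n⟫_ℝ ≤ ‖n‖ * ‖z - m‖ ^ 2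
  infDist_le : ∀ m ∈ M, ∀ w ∈ T m, infDist (m + w) M ≤ ‖w‖ ^ 2 / (2 * τ)
  sub_mem_orthogonal : ∀ x, ∀ m ∈ M, dist x m = infDist x M → x - m ∈ (T m)ᗮ

/-! ### Distance from tangent lines to `M` by a differential inequality -/

section Fencing

variable {E : Type*} [NormedAddCommGroup E] [InnerProductSpace ℝ E] {M : Set E} {τ : ℝ}
  {T : E → Submodule ℝ E}

/-- By the arithmetic–geometric mean inequality for `‖v‖` and `‖v + h • w‖`. It bounds the right
slope of the distance to `M` by the distance to a fixed nearest point. -/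
theorem norm_add_smul_le {v w : E} (hv : v ≠ 0) (hw : ‖w‖ = 1) (h : ℝ) :
    ‖v + h • w‖ ≤ ‖v‖ + h * (⟪v, w⟫_ℝ / ‖v‖ + h / (2 * ‖v‖)) := by
  have hpos : 0 < ‖v‖ := norm_pos_iff.2 hv
  have e : ‖v + h • w‖ ^ 2 = ‖v‖ ^ 2 + 2 * h * ⟪v, w⟫_ℝ + h ^ 2 := by
    rw [norm_add_sq_real, inner_smul_right, norm_smul, hw, mul_one, Real.norm_eq_abs, sq_abs]
    ring
  have e2 : ‖v‖ * (‖v‖ + h * (⟪v, w⟫_ℝ / ‖v‖ + h / (2 * ‖v‖))) =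
      (‖v‖ ^ 2 + ‖v + h • w‖ ^ 2) / 2 := by
    rw [e]; field_simp; ring
  refine le_of_mul_le_mul_left ?_ hpos
  rw [e2]
  nlinarith [sq_nonneg (‖v‖ - ‖v + h • w‖)]

/-- Let `g t` be the distance from `m + t • w` to `M`. Federer's inequality at the nearest point,
tested with `m`, bounds the slope of `g` by `(t² + 2τg + g²) / (2t(τ + g))`, and `g = √(τ² + t²) -
τ` solves the equality case. -/
theorem IsTangentField.infDist_le (hT : IsTangentField M T) (hM : IsCompact M) (hτ : 0 < τ)
    (hN : ∀ m ∈ M, ∀ n ∈ (T m)ᗮ, ∀ z ∈ M, 2 * τ * ⟪z - m, n⟫_ℝ ≤ ‖n‖ * ‖z - m‖ ^ 2)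
    {m : E} (hm : m ∈ M) {w : E} (hw : w ∈ T m) : infDist (m + w) M ≤ ‖w‖ ^ 2 / (2 * τ) := by
  suffices hunit : ∀ w ∈ T m, ‖w‖ = 1 → ∀ b : ℝ, 0 ≤ b → ∀ η : ℝ, 0 < η →
      infDist (m + b • w) M ≤ √(τ ^ 2 + (1 + η) * b ^ 2 + η * b) - τ by
    rcases eq_or_ne w 0 with rfl | hw0
    · simp [infDist_zero_of_mem hm]
    have hpos : 0 < ‖w‖ := norm_pos_iff.2 hw0
    have h1 := hunit (‖w‖⁻¹ • w) ((T m).smul_mem _ hw)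
      (by rw [norm_smul, norm_inv, norm_norm, inv_mul_cancel₀ hpos.ne']) ‖w‖ hpos.le
    rw [smul_smul, mul_inv_cancel₀ hpos.ne', one_smul] at h1
    have hlim : Tendsto (fun η : ℝ => √(τ ^ 2 + (1 + η) * ‖w‖ ^ 2 + η * ‖w‖) - τ) (𝓝[>] 0)
        (𝓝 (√(τ ^ 2 + (1 + 0) * ‖w‖ ^ 2 + 0 * ‖w‖) - τ)) :=
      ((by fun_prop : Continuous fun η : ℝ =>
        √(τ ^ 2 + (1 + η) * ‖w‖ ^ 2 + η * ‖w‖) - τ).tendsto 0).mono_left nhdsWithin_le_nhds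
    have h2 := ge_of_tendsto hlim (eventually_nhdsWithin_of_forall fun η hη => h1 η hη)
    have h3 : (τ + infDist (m + w) M) ^ 2 ≤ τ ^ 2 + ‖w‖ ^ 2 := by
      have h4 : τ + infDist (m + w) M ≤ √(τ ^ 2 + ‖w‖ ^ 2) := by
        simp only [add_zero, one_mul, zero_mul] at h2
        linarith
      calc _ ≤ √(τ ^ 2 + ‖w‖ ^ 2) ^ 2 :=
            pow_le_pow_left₀ (add_nonneg hτ.le infDist_nonneg) h4 2
        _ = _ := Real.sq_sqrt (by positivity)
    rw [le_div_iff₀ (by positivity)]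
    nlinarith [sq_nonneg (infDist (m + w) M)]
  clear hw w
  intro w hw hw1 b hb η hη
  set g : ℝ → ℝ := fun t => infDist (m + t • w) M with hg
  -- A perturbation of the exact solution that is a strict supersolution: `η * t²` gives strictness
  -- for positive `t`, and `η * t` gives a positive derivative at zero.
  set R : ℝ → ℝ := fun t => √(τ ^ 2 + (1 + η) * t ^ 2 + η * t) with hR
  have hRpos : ∀ t : ℝ, 0 ≤ t → 0 < R t := fun t ht => Real.sqrt_pos.2 (by positivity)
  have hRsq : ∀ t : ℝ, 0 ≤ t → R t ^ 2 = τ ^ 2 + (1 + η) * t ^ 2 + η * t :=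
    fun t ht => Real.sq_sqrt (by positivity)
  have hR0 : R 0 = τ := by simp [hR, Real.sqrt_sq hτ.le]
  have hgc : Continuous g := (continuous_infDist_pt M).comp (by fun_prop)
  have hgl : ∀ s t : ℝ, s < t → g t - g s ≤ t - s := by
    intro s t hst
    have h1 : g t ≤ g s + dist (m + t • w) (m + s • w) := infDist_le_infDist_add_dist
    rw [dist_eq_norm, add_sub_add_left_eq_sub, ← sub_smul, norm_smul, hw1, mul_one,
      Real.norm_of_nonneg (sub_nonneg.2 hst.le)] at h1
    linarith
  classical
  refine image_le_of_liminf_slope_right_lt_deriv_boundary' (f := g) (a := 0) (b := b)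
    -- The strict comparison is needed only where `g` touches the barrier; elsewhere the Lipschitz
    -- bound `1` serves, and at zero the slope vanishes by tangency.
    (f' := fun t => if t = 0 then 0 else if g t = R t - τ then
      (t ^ 2 + 2 * τ * g t + g t ^ 2) / (2 * t * (τ + g t)) else 1)
    (B := fun t => R t - τ) (B' := fun t => (2 * (1 + η) * t + η) / (2 * R t))
    hgc.continuousOn ?_ ?_ ?_ ?_ ?_ (right_mem_Icc.2 hb)
  · intro t ht r hr
    refine Eventually.frequently ?_
    split_ifs at hr with h0 htouch
    · subst h0
      have hlo := isLittleO_iff.1 (hT.infDist_isLittleO m hm w hw) (half_pos hr)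
      filter_upwards [nhdsWithin_le_nhds hlo, self_mem_nhdsWithin] with z hz hz0
      rw [slope_def_field, div_lt_iff₀ (by simpa using hz0)]
      rw [mem_Ioi] at hz0
      rw [Real.norm_of_nonneg infDist_nonneg, Real.norm_of_nonneg hz0.le] at hz
      have : g 0 = 0 := by simp [hg, infDist_zero_of_mem hm]
      rw [this]
      nlinarith [mul_pos hr hz0]
    · have ht0 : 0 < t := lt_of_le_of_ne ht.1 (Ne.symm h0)
      have hgpos : 0 < g t := by
        have h1 := hRsq t ht.1
        have h2 : τ < R t := by
          refine lt_of_pow_lt_pow_left₀ 2 (hRpos t ht.1).le ?_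
          rw [h1]
          nlinarith [mul_pos hη ht0, mul_pos ht0 ht0, mul_pos hη (mul_pos ht0 ht0)]
        linarith
      obtain ⟨q, hq, hqd⟩ := hM.exists_infDist_eq_dist ⟨m, hm⟩ (m + t • w)
      set v := m + t • w - q with hv
      have hvg : ‖v‖ = g t := by rw [hv, ← dist_eq_norm]; exact hqd.symm
      have hv0 : v ≠ 0 := by rw [← norm_pos_iff, hvg]; exact hgpos
      have hvN : v ∈ (T q)ᗮ := hT.sub_mem_orthogonal hq hqd.symm
      have h1 := hN q hq (-v) ((T q)ᗮ.neg_mem hvN) m hm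
      have hmq : m - q = v - t • w := by rw [hv]; abel
      clear_value v
      rw [hmq, norm_neg, inner_neg_right, inner_sub_left, real_inner_self_eq_norm_sq,
        norm_sub_sq_real, inner_smul_left, inner_smul_right, norm_smul, hw1, hvg,
        Real.norm_of_nonneg ht0.le, real_inner_comm] at h1
      simp only [conj_trivial, mul_one] at h1
      have hslope : ⟪v, w⟫_ℝ / g t ≤ (t ^ 2 + 2 * τ * g t + g t ^ 2) / (2 * t * (τ + g t)) := by
        rw [div_le_div_iff₀ hgpos (by positivity)]
        nlinarith
      have hlim : Tendsto (fun z : ℝ => ⟪v, w⟫_ℝ / g t + (z - t) / (2 * g t)) (𝓝[>] t)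
          (𝓝 (⟪v, w⟫_ℝ / g t + (t - t) / (2 * g t))) :=
        ((by fun_prop : Continuous fun z : ℝ =>
          ⟪v, w⟫_ℝ / g t + (z - t) / (2 * g t)).tendsto t).mono_left nhdsWithin_le_nhds
      have hev := hlim.eventually_lt_const (u := r)
        (by rw [sub_self, zero_div, add_zero]; exact hslope.trans_lt hr)
      filter_upwards [hev, self_mem_nhdsWithin] with z hz hzt
      rw [mem_Ioi] at hzt
      refine lt_of_le_of_lt ?_ hz
      rw [slope_def_field, div_le_iff₀ (sub_pos.2 hzt)]
      have h2 : g z ≤ ‖v + (z - t) • w‖ := by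
        have : v + (z - t) • w = m + z • w - q := by rw [hv, sub_smul]; abel
        rw [this, ← dist_eq_norm]
        exact infDist_le_dist_of_mem hq
      have h3 := norm_add_smul_le hv0 hw1 (z - t)
      rw [hvg] at h3
      linarith
    · filter_upwards [self_mem_nhdsWithin] with z hz
      refine lt_of_le_of_lt ?_ hr
      rw [slope_def_field, div_le_one (sub_pos.2 hz)]
      exact hgl t z hz
  · simp [hR0, hg, infDist_zero_of_mem hm]
  · exact Continuous.continuousOn (by fun_prop)
  · intro t ht
    have hin : HasDerivAt (fun t : ℝ => τ ^ 2 + (1 + η) * t ^ 2 + η * t)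
        (2 * (1 + η) * t + η) t := by
      have := (((hasDerivAt_pow 2 t).const_mul (1 + η)).const_add (τ ^ 2)).add
        ((hasDerivAt_id t).const_mul η)
      refine this.congr_deriv ?_
      simp
      ring
    exact ((hin.sqrt (by have := ht.1; positivity)).sub_const τ).hasDerivWithinAt
  · intro t ht htouch
    have hRp := hRpos t ht.1
    simp only [htouch, if_true]
    split_ifs with h0
    · subst h0; positivity
    · have ht0 : 0 < t := lt_of_le_of_ne ht.1 (Ne.symm h0)
      have e : τ + (R t - τ) = R t := by ring
      rw [e, div_lt_div_iff₀ (by positivity) (by positivity)]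
      have e2 : t ^ 2 + 2 * τ * (R t - τ) + (R t - τ) ^ 2 = t * ((2 + η) * t + η) := by
        linear_combination hRsq t ht.1
      rw [e2]
      have : 0 < 2 * (R t * t) * (η * t) := by positivity
      nlinarith

theorem IsTangentField.hasReachGeometry [FiniteDimensional ℝ E] (hT : IsTangentField M T)
    (hM : IsCompact M) (hτ : 0 < τ)
    (hU : ∀ x, infDist x M < τ → ∃! m, m ∈ M ∧ dist x m = infDist x M) :
    HasReachGeometry M τ T where
  isCompact := hM
  pos := hτ
  inner_le _ hm _ hn _ hz := hT.inner_le_of_unique_nearest hM hτ hU hm hn hz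
  infDist_le _ hm _ hw := hT.infDist_le hM hτ
    (fun _ hm _ hn _ hz => hT.inner_le_of_unique_nearest hM hτ hU hm hn hz) hm hw
  sub_mem_orthogonal _ _ hm hx := hT.sub_mem_orthogonal hm hx

end Fencing

theorem unique_nearest_of_reach {D : ℕ} {M : Set (EuclideanSpace ℝ (Fin D))} {τ : ℝ}
    (hne : M.Nonempty) (hτ : reach M = ENNReal.ofReal τ) (x : EuclideanSpace ℝ (Fin D))
    (hx : infDist x M < τ) : ∃! m, m ∈ M ∧ dist x m = infDist x M := by
  have hlt : ENNReal.ofReal (infDist x M) < reach M := by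
    rw [hτ]
    exact (ENNReal.ofReal_lt_ofReal_iff (infDist_nonneg.trans_lt hx)).2 hx
  rw [reach, lt_iSup_iff] at hlt
  obtain ⟨r, hr⟩ := hlt
  rw [lt_iSup_iff] at hr
  obtain ⟨hsub, hr⟩ := hr
  refine hsub ?_
  rw [mem_thickening_iff_infDist_lt hne]
  rw [← ENNReal.ofReal_coe_nnreal] at hr
  exact (ENNReal.ofReal_lt_ofReal_iff_of_nonneg infDist_nonneg).1 hr

/-! ### Metric consequences of the reach -/

section Projection

variable {E : Type*} [NormedAddCommGroup E] [InnerProductSpace ℝ E] (K : Submodule ℝ E)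
  [K.HasOrthogonalProjection]

theorem inner_starProjection_of_mem (x : E) {n : E} (hn : n ∈ K) :
    ⟪K.starProjection x, n⟫_ℝ = ⟪x, n⟫_ℝ := by
  have := K.starProjection_inner_eq_zero x n hn
  rw [inner_sub_left] at this
  linarith

theorem norm_starProjection_le_of_inner_le {x : E} {C : ℝ} (hC : 0 ≤ C)
    (h : ∀ n ∈ K, ⟪x, n⟫_ℝ ≤ C * ‖n‖) : ‖K.starProjection x‖ ≤ C := by
  have h1 := h _ (K.starProjection_apply_mem x)
  rw [← inner_starProjection_of_mem K x (K.starProjection_apply_mem x),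
    real_inner_self_eq_norm_sq] at h1
  by_contra! hlt
  nlinarith [norm_nonneg (K.starProjection x)]

end Projection

/-- For `ε = 0` this is the parallelogram law: the half sum and half difference of two vectors of
length `ℓ` have squared norms adding up to `ℓ²`. A triangle inequality for one midpoint would lose
the sharp constant in `inner_normal_sub_le`. -/
theorem norm_sq_add_norm_sq_le_of_near {E : Type*} [NormedAddCommGroup E] [InnerProductSpace ℝ E]
    {a₁ a₂ v e : E} {ℓ ε : ℝ} (hv : ‖v‖ = ℓ) (he : ‖e‖ = ℓ) (hε : ε ≤ ℓ)
    (h₁ : ‖a₁ - (1 / 2 : ℝ) • (v + e)‖ ≤ ε) (h₂ : ‖a₂ - (1 / 2 : ℝ) • (v + -e)‖ ≤ ε) :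
    ‖a₁‖ ^ 2 + ‖a₂‖ ^ 2 ≤ ℓ ^ 2 + 6 * ℓ * ε := by
  have hsq : ∀ a b : E, ‖b‖ ≤ ℓ → ‖a - b‖ ≤ ε → ‖a‖ ^ 2 ≤ ‖b‖ ^ 2 + 3 * ℓ * ε := by
    intro a b hb hab
    have h0 : 0 ≤ ε := (norm_nonneg _).trans hab
    have h1 : ‖a‖ ≤ ‖b‖ + ε := by
      have := norm_add_le (a - b) b
      rw [sub_add_cancel] at this
      linarith
    have h2 := pow_le_pow_left₀ (norm_nonneg a) h1 2
    nlinarith [mul_le_mul_of_nonneg_right hb h0, mul_le_mul_of_nonneg_right hε h0]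
  have hhalf : ∀ b : E, ‖b‖ = ℓ → ‖(1 / 2 : ℝ) • (v + b)‖ ≤ ℓ := by
    intro b hb
    rw [norm_smul, Real.norm_of_nonneg (by norm_num)]
    have := norm_add_le v b
    linarith
  have q₁ := hsq a₁ _ (hhalf e he) h₁
  have q₂ := hsq a₂ _ (hhalf (-e) (by rwa [norm_neg])) h₂
  have hpar := parallelogram_law_with_norm ℝ v e
  rw [hv, he] at hpar
  rw [norm_smul, Real.norm_of_nonneg (by norm_num)] at q₁ q₂
  rw [← sub_eq_add_neg] at q₂
  linarith

namespace HasReachGeometry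

variable {E : Type*} [NormedAddCommGroup E] [InnerProductSpace ℝ E] {M : Set E} {τ : ℝ}
  {T : E → Submodule ℝ E}

theorem exists_dist_le (h : HasReachGeometry M τ T) {m : E} (hm : m ∈ M) {w : E} (hw : w ∈ T m) :
    ∃ z ∈ M, dist (m + w) z ≤ ‖w‖ ^ 2 / (2 * τ) := by
  obtain ⟨z, hz, hd⟩ := h.isCompact.exists_infDist_eq_dist ⟨m, hm⟩ (m + w)
  exact ⟨z, hz, hd ▸ h.infDist_le m hm w hw⟩

/-- Points on tangent lines do not enter normal balls too far. -/
theorem inner_add_le (h : HasReachGeometry M τ T) {y z : E} (hy : y ∈ M) (hz : z ∈ M) {n w : E}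
    (hn : n ∈ (T y)ᗮ) (hn1 : ‖n‖ = 1) (hw : w ∈ T z) (hwτ : ‖w‖ ≤ τ) :
    2 * τ * ⟪z + w - y, n⟫_ℝ ≤ ‖z + w - y‖ ^ 2 + ‖w‖ ^ 2 := by
  have hτ := h.pos
  obtain ⟨m, hm, hd⟩ := h.exists_dist_le hz hw
  have h1 := h.inner_le y hy n hn m hm
  have e : ∀ x : E, ‖x - y - τ • n‖ ^ 2 = ‖x - y‖ ^ 2 - 2 * τ * ⟪x - y, n⟫_ℝ + τ ^ 2 := by
    intro x
    rw [norm_sub_sq_real, inner_smul_right, norm_smul, hn1, Real.norm_of_nonneg hτ.le]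
    ring
  -- `m` lies outside the normal ball centred at `y + τ • n`, so the tangent point `z + w`, which is
  -- near `m`, cannot enter it far.
  have h2 : τ ≤ ‖m - y - τ • n‖ := by
    refine le_of_sq_le_sq ?_ (norm_nonneg _)
    rw [e]
    rw [hn1] at h1
    linarith
  have h3 : τ - ‖w‖ ^ 2 / (2 * τ) ≤ ‖z + w - y - τ • n‖ := by
    have : m - y - τ • n = (z + w - y - τ • n) - (z + w - m) := by abel
    rw [this] at h2
    rw [dist_eq_norm] at hd
    have := norm_sub_le (z + w - y - τ • n) (z + w - m)
    linarith
  have h0 : ‖w‖ ^ 2 / (2 * τ) ≤ τ := by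
    rw [div_le_iff₀ (by positivity)]
    nlinarith [norm_nonneg w]
  have h4 := pow_le_pow_left₀ (sub_nonneg.2 h0) h3 2
  rw [e] at h4
  have h5 : τ * (‖w‖ ^ 2 / (2 * τ)) = ‖w‖ ^ 2 / 2 := by field_simp
  nlinarith [sq_nonneg (‖w‖ ^ 2 / (2 * τ))]

/-- The tangent spaces vary in a Lipschitz way. -/
theorem inner_le_mul_norm (h : HasReachGeometry M τ T) {y z : E} (hy : y ∈ M) (hz : z ∈ M)
    (hyz : ‖z - y‖ ≤ τ) {n u : E} (hn : n ∈ (T y)ᗮ) (hu : u ∈ T z) :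
    τ * ⟪u, n⟫_ℝ ≤ 3 / 2 * ‖z - y‖ * ‖u‖ * ‖n‖ := by
  rcases eq_or_ne z y with rfl | hne
  · rw [(Submodule.mem_orthogonal _ _).1 hn u hu]; simp
  suffices hunit : ∀ n ∈ (T y)ᗮ, ∀ u ∈ T z, ‖n‖ = 1 → ‖u‖ = 1 →
      τ * ⟪u, n⟫_ℝ ≤ 3 / 2 * ‖z - y‖ by
    rcases eq_or_ne n 0 with rfl | hn0
    · simp
    rcases eq_or_ne u 0 with rfl | hu0
    · simp
    have hpn : 0 < ‖n‖ := norm_pos_iff.2 hn0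
    have hpu : 0 < ‖u‖ := norm_pos_iff.2 hu0
    have := hunit (‖n‖⁻¹ • n) ((T y)ᗮ.smul_mem _ hn) (‖u‖⁻¹ • u) ((T z).smul_mem _ hu)
      (by rw [norm_smul, norm_inv, norm_norm, inv_mul_cancel₀ hpn.ne'])
      (by rw [norm_smul, norm_inv, norm_norm, inv_mul_cancel₀ hpu.ne'])
    rw [inner_smul_right, real_inner_smul_left] at this
    calc τ * ⟪u, n⟫_ℝ = (τ * (‖n‖⁻¹ * (‖u‖⁻¹ * ⟪u, n⟫_ℝ))) * (‖u‖ * ‖n‖) := by field_simp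
      _ ≤ (3 / 2 * ‖z - y‖) * (‖u‖ * ‖n‖) := by gcongr
      _ = _ := by ring
  clear hn hu n u
  intro n hn u hu hn1 hu1
  set δ := ‖z - y‖ with hδ
  have hδ0 : 0 < δ := norm_pos_iff.2 (sub_ne_zero.2 hne)
  have hnδ : ‖δ • u‖ = δ := by rw [norm_smul, hu1, mul_one, Real.norm_of_nonneg hδ0.le]
  have hnδ' : ‖-(δ • u)‖ = δ := by rw [norm_neg, hnδ]
  -- Test with the tangent vectors `δ • u` and `-(δ • u)` against `n` and `-n`. On adding, the terms
  -- in `⟪z - y, n⟫` and the cross terms cancel, and `6δ²` remains on the right.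
  have h1 := h.inner_add_le hy hz hn hn1 ((T z).smul_mem δ hu) (hnδ.trans_le hyz)
  have h2 := h.inner_add_le hy hz ((T y)ᗮ.neg_mem hn) (by rwa [norm_neg])
    ((T z).neg_mem ((T z).smul_mem δ hu)) (hnδ'.trans_le hyz)
  have e1 : z + δ • u - y = (z - y) + δ • u := by abel
  have e2 : z + -(δ • u) - y = (z - y) - δ • u := by abel
  rw [e1, inner_add_left, real_inner_smul_left, norm_add_sq_real, hnδ] at h1
  rw [e2, inner_neg_right, inner_sub_left, real_inner_smul_left, norm_sub_sq_real, norm_neg,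
    hnδ] at h2
  have h3 : δ * (τ * ⟪u, n⟫_ℝ) ≤ δ * (3 / 2 * δ) := by nlinarith
  exact le_of_mul_le_mul_left h3 hδ0

/-- The sum of four instances of Federer's inequality, at the two feet `z`, `z'` and tested with the
two points `m₁`, `m₂`. It limits how fast a normal field can vary along a chord of `M`. -/
theorem inner_sub_normal_le (h : HasReachGeometry M τ T) {z z' n n' m₁ m₂ : E} {σ : ℝ}
    (hz : z ∈ M) (hz' : z' ∈ M) (hm₁ : m₁ ∈ M) (hm₂ : m₂ ∈ M) (hn : n ∈ (T z)ᗮ)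
    (hn' : n' ∈ (T z')ᗮ) (hnσ : ‖n‖ ≤ σ) (hnσ' : ‖n'‖ ≤ σ) :
    2 * τ * ⟪m₁ - m₂, n - n'⟫_ℝ ≤
      σ * ((‖m₁ - z‖ ^ 2 + ‖m₂ - z‖ ^ 2) + (‖m₁ - z'‖ ^ 2 + ‖m₂ - z'‖ ^ 2)) := by
  have i₁ := h.inner_le z hz n hn m₁ hm₁
  have i₂ := h.inner_le z hz (-n) ((T z)ᗮ.neg_mem hn) m₂ hm₂
  have i₃ := h.inner_le z' hz' (-n') ((T z')ᗮ.neg_mem hn') m₁ hm₁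
  have i₄ := h.inner_le z' hz' n' hn' m₂ hm₂
  rw [norm_neg, inner_neg_right] at i₂ i₃
  have hmk : ⟪m₁ - m₂, n - n'⟫_ℝ = ⟪m₁ - z, n⟫_ℝ - ⟪m₂ - z, n⟫_ℝ - ⟪m₁ - z', n'⟫_ℝ +
      ⟪m₂ - z', n'⟫_ℝ := by
    simp only [inner_sub_right, inner_sub_left]
    ring
  have j₁ := mul_le_mul_of_nonneg_right hnσ (sq_nonneg ‖m₁ - z‖)
  have j₂ := mul_le_mul_of_nonneg_right hnσ (sq_nonneg ‖m₂ - z‖)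
  have j₃ := mul_le_mul_of_nonneg_right hnσ' (sq_nonneg ‖m₁ - z'‖)
  have j₄ := mul_le_mul_of_nonneg_right hnσ' (sq_nonneg ‖m₂ - z'‖)
  rw [hmk]
  linarith

variable [FiniteDimensional ℝ E]

theorem norm_starProjection_orthogonal_le (h : HasReachGeometry M τ T) {y z : E} (hy : y ∈ M)
    (hz : z ∈ M) : ‖(T y)ᗮ.starProjection (z - y)‖ ≤ ‖z - y‖ ^ 2 / (2 * τ) := by
  have hτ := h.pos
  refine norm_starProjection_le_of_inner_le _ (by positivity) fun n hn => ?_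
  rw [div_mul_eq_mul_div, le_div_iff₀ (by positivity)]
  linarith [h.inner_le y hy n hn z hz]

theorem norm_starProjection_orthogonal_tangent_le (h : HasReachGeometry M τ T) {y z u : E}
    (hy : y ∈ M) (hz : z ∈ M) (hyz : ‖z - y‖ ≤ τ) (hu : u ∈ T z) :
    ‖(T y)ᗮ.starProjection u‖ ≤ 3 / 2 * ‖z - y‖ * ‖u‖ / τ := by
  have hτ := h.pos
  refine norm_starProjection_le_of_inner_le _ (by positivity) fun n hn => ?_
  rw [div_mul_eq_mul_div, le_div_iff₀ (by positivity)]
  linarith [h.inner_le_mul_norm hy hz hyz hn hu]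

/-- Chords of `M` near `y` are almost tangent at `y`. -/
theorem norm_starProjection_orthogonal_chord_le (h : HasReachGeometry M τ T) {y z z' : E} {r : ℝ}
    (hy : y ∈ M) (hz : z ∈ M) (hz' : z' ∈ M) (hzr : ‖z - y‖ ≤ r) (hzr' : ‖z' - y‖ ≤ r)
    (hr : r ≤ τ) :
    ‖(T y)ᗮ.starProjection (z' - z)‖ ≤ 2 * r / τ * ‖z' - z‖ := by
  have hτ := h.pos
  have hr0 : 0 ≤ r := (norm_nonneg _).trans hzr
  refine norm_starProjection_le_of_inner_le _ (by positivity) fun n hn => ?_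
  rw [div_mul_eq_mul_div, div_mul_eq_mul_div, le_div_iff₀ (by positivity)]
  -- For long chords compare both ends with `y`. A short chord is tangent at `z` up to `‖z' - z‖² /
  -- (2τ)`, and tangents at `z` tilt against `T y` by at most `3r / (2τ)`; the total is `7r / (4τ)`
  -- relative to the length.
  rcases le_or_gt (r / 2) ‖z' - z‖ with hl | hl
  · have h1 := h.inner_le y hy n hn z' hz'
    have h2 := h.inner_le y hy (-n) ((T y)ᗮ.neg_mem hn) z hz
    rw [inner_neg_right, norm_neg] at h2
    have e : ⟪z' - z, n⟫_ℝ = ⟪z' - y, n⟫_ℝ - ⟪z - y, n⟫_ℝ := by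
      rw [← inner_sub_left, sub_sub_sub_cancel_right]
    have h3 : ‖z - y‖ ^ 2 ≤ r ^ 2 := by gcongr
    have h4 : ‖z' - y‖ ^ 2 ≤ r ^ 2 := by gcongr
    rw [e]
    nlinarith [mul_le_mul_of_nonneg_left h3 (norm_nonneg n),
      mul_le_mul_of_nonneg_left h4 (norm_nonneg n),
      mul_le_mul_of_nonneg_left hl (mul_nonneg hr0 (norm_nonneg n))]
  · have e := (T z).starProjection_add_starProjection_orthogonal (z' - z)
    have h1 := h.inner_le_mul_norm hy hz (hzr.trans hr) hn ((T z).starProjection_apply_mem (z' - z))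
    have h2 := h.norm_starProjection_orthogonal_le hz hz'
    rw [le_div_iff₀ (by positivity)] at h2
    have h3 := (T z).norm_starProjection_apply_le (z' - z)
    have h4 : ⟪(T z)ᗮ.starProjection (z' - z), n⟫_ℝ ≤
        ‖(T z)ᗮ.starProjection (z' - z)‖ * ‖n‖ := real_inner_le_norm _ _
    have h5 : ⟪z' - z, n⟫_ℝ = ⟪(T z).starProjection (z' - z), n⟫_ℝ +
        ⟪(T z)ᗮ.starProjection (z' - z), n⟫_ℝ := by rw [← inner_add_left, e]
    have h6 : 3 / 2 * ‖z - y‖ * ‖(T z).starProjection (z' - z)‖ * ‖n‖ ≤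
        3 / 2 * r * ‖z' - z‖ * ‖n‖ := by gcongr
    have h7 : ‖z' - z‖ ^ 2 * ‖n‖ ≤ (r / 2 * ‖z' - z‖) * ‖n‖ := by
      rw [sq]; gcongr
    rw [h5]
    nlinarith [mul_le_mul_of_nonneg_right h2 (norm_nonneg n), mul_le_mul_of_nonneg_left h4 hτ.le,
      mul_nonneg (mul_nonneg hr0 (norm_nonneg (z' - z))) (norm_nonneg n)]

/-- First order optimality condition for the projection of `M` to a subspace. -/
theorem mem_orthogonal_of_norm_le (h : HasReachGeometry M τ T) {K : Submodule ℝ E} {m e : E}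
    (hm : m ∈ M) (heK : e ∈ K) {δ : ℝ} (hδ : 0 < δ)
    (hmin : ∀ q ∈ M, ‖q - m‖ < δ → ‖e‖ ≤ ‖e + K.starProjection (q - m)‖) : e ∈ (T m)ᗮ := by
  have hτ := h.pos
  suffices hcrit : ∀ u ∈ T m, 0 ≤ ⟪u, e⟫_ℝ by
    rw [Submodule.mem_orthogonal]
    intro u hu
    refine le_antisymm ?_ (hcrit u hu)
    have := hcrit (-u) ((T m).neg_mem hu)
    rw [inner_neg_left] at this
    linarith
  intro u hu
  by_contra! hneg
  set C := ‖u‖ ^ 2 / (2 * τ) with hC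
  have hC0 : 0 ≤ C := by positivity
  have hu0 := norm_nonneg u
  have he0 := norm_nonneg e
  -- A step along `u`, short enough that the point of `M` near `m + k • u` stays within `δ` of `m`
  -- and the linear decrease of `‖e + ·‖²` outweighs the quadratic terms.
  obtain ⟨k, hk0, hk⟩ := exists_between (lt_min one_pos (lt_min
    (div_pos hδ (by positivity : 0 < ‖u‖ + C + 1))
    (div_pos (neg_pos.2 hneg) (by positivity : 0 < 2 * C * ‖e‖ + (‖u‖ + C) ^ 2 + 1))))
  obtain ⟨hk1, hk2, hk3⟩ := lt_min_iff.1 hk |>.imp_right lt_min_iff.1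
  rw [lt_div_iff₀ (by positivity)] at hk2 hk3
  obtain ⟨q, hq, hqd⟩ := h.exists_dist_le hm ((T m).smul_mem k hu)
  have hqC : ‖q - m - k • u‖ ≤ C * k ^ 2 := by
    rw [dist_comm, dist_eq_norm, norm_smul, Real.norm_of_nonneg hk0.le] at hqd
    rw [sub_sub]
    refine hqd.trans_eq ?_
    rw [hC]; ring
  have hkk : C * k ^ 2 ≤ C * k := mul_le_mul_of_nonneg_left (by nlinarith) hC0
  have hqm : ‖q - m‖ ≤ k * (‖u‖ + C) := by
    have := norm_add_le (q - m - k • u) (k • u)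
    rw [sub_add_cancel, norm_smul, Real.norm_of_nonneg hk0.le] at this
    linarith
  have h2 : ‖e‖ ^ 2 ≤ ‖e + K.starProjection (q - m)‖ ^ 2 :=
    pow_le_pow_left₀ he0 (hmin q hq (by linarith)) 2
  rw [norm_add_sq_real, real_inner_comm, inner_starProjection_of_mem _ _ heK] at h2
  have h3 : ‖K.starProjection (q - m)‖ ^ 2 ≤ (k * (‖u‖ + C)) ^ 2 :=
    pow_le_pow_left₀ (norm_nonneg _) ((K.norm_starProjection_apply_le _).trans hqm) 2
  have h4 : ⟪q - m, e⟫_ℝ ≤ k * ⟪u, e⟫_ℝ + C * k ^ 2 * ‖e‖ := by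
    have h5 : ⟪q - m, e⟫_ℝ = ⟪q - m - k • u, e⟫_ℝ + k * ⟪u, e⟫_ℝ := by
      rw [← real_inner_smul_left, ← inner_add_left, sub_add_cancel]
    have h6 := real_inner_le_norm (q - m - k • u) e
    have := mul_le_mul_of_nonneg_right hqC he0
    linarith
  have h5 : 0 ≤ k * (2 * ⟪u, e⟫_ℝ + k * (2 * C * ‖e‖ + (‖u‖ + C) ^ 2)) := by linarith
  have h6 := nonneg_of_mul_nonneg_right h5 hk0
  linarith

/-- The orthogonal projection of a piece of `M` to a tangent space covers a ball. -/
theorem exists_starProjection_eq (h : HasReachGeometry M τ T) {y w : E} (hy : y ∈ M)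
    (hw : w ∈ T y) {s : ℝ} (hs : 0 < s) (hsτ : s ≤ τ / 2)
    (hws : ‖w‖ < s * √(1 - (s / (2 * τ)) ^ 2)) :
    ∃ m ∈ M, ‖m - y‖ < s ∧ (T y).starProjection (m - y) = w := by
  have hτ := h.pos
  set ρ := s * √(1 - (s / (2 * τ)) ^ 2) with hρ
  have hρsq : ρ ^ 2 = s ^ 2 - (s ^ 2 / (2 * τ)) ^ 2 := by
    rw [hρ, mul_pow, Real.sq_sqrt]
    · ring
    · have : s / (2 * τ) ≤ 1 := by rw [div_le_one (by positivity)]; linarith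
      nlinarith [div_pos hs (by positivity : 0 < 2 * τ)]
  set P := (T y).starProjection with hP
  -- Points of `M` on the sphere of radius `s` have normal part at most `s² / (2τ)`, hence project
  -- outside the open ball of radius `ρ`.
  have hbd : ∀ m ∈ M, ‖m - y‖ = s → ρ ≤ ‖P (m - y)‖ := by
    intro m hm hms
    refine le_of_sq_le_sq ?_ (norm_nonneg _)
    have h1 := Submodule.norm_sq_eq_add_norm_sq_starProjection (m - y) (T y)
    have h2 := pow_le_pow_left₀ (norm_nonneg _) (h.norm_starProjection_orthogonal_le hy hm) 2
    rw [hms] at h1 h2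
    rw [hρsq]
    linarith
  set K := M ∩ closedBall y s with hK
  have hKc : IsCompact K := h.isCompact.inter_right isClosed_closedBall
  have hFc : Continuous fun m => P (m - y) := by fun_prop
  set A : Set ℝ := {t | ∃ m ∈ K, P (m - y) = t • w} with hA
  have hlt : ∀ t ∈ Icc (0 : ℝ) 1, ∀ m ∈ K, P (m - y) = t • w → ‖m - y‖ < s := by
    intro t ht m hm hmt
    have hms : ‖m - y‖ ≤ s := by rw [← dist_eq_norm]; exact hm.2
    refine lt_of_le_of_ne hms fun he => ?_
    have h1 := hbd m hm.1 he
    rw [hmt, norm_smul, Real.norm_of_nonneg ht.1] at h1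
    nlinarith [norm_nonneg w, ht.2]
  suffices hsub : Icc (0 : ℝ) 1 ⊆ A by
    obtain ⟨m, hm, hmw⟩ := hsub (right_mem_Icc.2 zero_le_one)
    refine ⟨m, hm.1, hlt 1 (right_mem_Icc.2 zero_le_one) m hm hmw, ?_⟩
    rw [hmw, one_smul]
  have hAcl : IsClosed A := by
    have : A = (fun t : ℝ => t • w) ⁻¹' ((fun m => P (m - y)) '' K) := by
      ext t
      simp [hA]
    rw [this]
    exact (hKc.image hFc).isClosed.preimage (by fun_prop)
  -- Continuity method along the segment from `0` to `w`: the set of covered parameters is closed by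
  -- compactness, and it remains to cover parameters slightly to the right.
  refine IsClosed.Icc_subset_of_forall_exists_gt (hAcl.inter isClosed_Icc)
    ⟨y, ⟨hy, mem_closedBall_self hs.le⟩, by simp⟩ ?_
  rintro t ⟨⟨m₀, hm₀, hm₀t⟩, ht⟩ b hb
  rw [mem_Ioi] at hb
  obtain ⟨t', htt', ht'⟩ := exists_between (lt_min hb (lt_min ht.2
    (lt_add_of_pos_right t (div_pos (sub_pos.2 hws) (by positivity : 0 < ‖w‖ + 1)))))
  obtain ⟨ht'b, ht'1, ht'w⟩ := lt_min_iff.1 ht' |>.imp_right lt_min_iff.1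
  refine ⟨t', ?_, htt', ht'b.le⟩
  have hstep : (t' - t) * ‖w‖ < ρ - ‖w‖ := by
    have h1 : (t' - t) * (‖w‖ + 1) < ρ - ‖w‖ := by
      rw [← lt_div_iff₀ (by positivity)]; linarith
    nlinarith
  obtain ⟨m, hmK, hmin⟩ := hKc.exists_isMinOn ⟨m₀, hm₀⟩
    (f := fun m => ‖P (m - y) - t' • w‖) (by fun_prop)
  set e := P (m - y) - t' • w with he
  have hms : ‖m - y‖ < s := by
    have hms : ‖m - y‖ ≤ s := by rw [← dist_eq_norm]; exact hmK.2
    refine lt_of_le_of_ne hms fun hes => ?_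
    have h1 := hbd m hmK.1 hes
    have h2 : ‖e‖ ≤ ‖P (m₀ - y) - t' • w‖ := hmin hm₀
    rw [hm₀t, ← sub_smul, norm_smul, Real.norm_eq_abs, abs_sub_comm,
      abs_of_pos (sub_pos.2 htt')] at h2
    have h3 : ‖P (m - y)‖ ≤ ‖e‖ + ‖t' • w‖ := by
      have := norm_add_le e (t' • w)
      rwa [he, sub_add_cancel] at this
    rw [norm_smul, Real.norm_of_nonneg (ht.1.trans htt'.le)] at h3
    nlinarith [norm_nonneg w]
  have heT : e ∈ T y := (T y).sub_mem ((T y).starProjection_apply_mem _) ((T y).smul_mem _ hw)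
  have heN : e ∈ (T m)ᗮ := by
    refine h.mem_orthogonal_of_norm_le hmK.1 heT (sub_pos.2 hms) fun q hq hqm => ?_
    have hqK : q ∈ K := by
      refine ⟨hq, ?_⟩
      rw [mem_closedBall, dist_eq_norm]
      have := norm_add_le (q - m) (m - y)
      rw [sub_add_sub_cancel] at this
      linarith
    have e1 : P (q - y) - t' • w = e + P (q - m) := by
      rw [he, ← sub_add_sub_cancel q m y, map_add]; abel
    exact e1 ▸ hmin hqK
  -- The error `e` at the minimizer is tangent at `y` and normal at `m`. These spaces are nearly
  -- orthogonal, so `τ‖e‖² ≤ (3/2) s ‖e‖²`, and `s ≤ τ / 2` leaves only `e = 0`.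
  have h1 := h.inner_le_mul_norm hmK.1 hy (by rw [norm_sub_rev]; linarith) heN heT
  rw [real_inner_self_eq_norm_sq, norm_sub_rev y] at h1
  have h2 : ‖e‖ = 0 := by
    by_contra hne
    have hpos : 0 < ‖e‖ := lt_of_le_of_ne (norm_nonneg e) (Ne.symm hne)
    nlinarith [mul_pos hpos hpos]
  exact ⟨m, hmK, sub_eq_zero.1 (norm_eq_zero.1 h2)⟩

/-- `M` comes close to the points `(z + z' + e) / 2`, where `e` is tangent at a nearby point. -/
theorem exists_norm_sub_midpoint_le (h : HasReachGeometry M τ T) {z₀ z z' e : E} {η : ℝ}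
    (hz₀ : z₀ ∈ M) (hz : z ∈ M) (hz' : z' ∈ M) (hzη : ‖z - z₀‖ ≤ η) (hzη' : ‖z' - z₀‖ ≤ η)
    (hητ : η ≤ τ) (he : e ∈ T z₀) (hel : ‖e‖ = ‖z' - z‖) :
    ∃ m ∈ M, ‖m - (z + (1 / 2 : ℝ) • (z' - z + e))‖ ≤ 3 * η / τ * ‖z' - z‖ := by
  have hτ := h.pos
  set b := (1 / 2 : ℝ) • (z' - z + e) with hb
  set ℓ := ‖z' - z‖ with hℓ
  have hℓη : ℓ ≤ 2 * η := by
    have := norm_sub_le (z' - z₀) (z - z₀)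
    rw [sub_sub_sub_cancel_right] at this
    linarith
  have hbl : ‖b‖ ≤ ℓ := by
    rw [hb, norm_smul, Real.norm_of_nonneg (by norm_num)]
    have := norm_add_le (z' - z) e
    linarith
  obtain ⟨m, hm, hd⟩ := h.exists_dist_le hz ((T z).starProjection_apply_mem b)
  refine ⟨m, hm, ?_⟩
  -- The part of `b` tangent at `z` leads close to `M`; its normal part is small since both the
  -- chord and `e` are almost tangent at `z`.
  have e1 : m - (z + b) = -(z + (T z).starProjection b - m) - (T z)ᗮ.starProjection b := by
    conv_lhs => rw [← (T z).starProjection_add_starProjection_orthogonal b]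
    abel
  have h1 : ‖m - (z + b)‖ ≤ ‖z + (T z).starProjection b - m‖ + ‖(T z)ᗮ.starProjection b‖ := by
    rw [e1, ← norm_neg (z + (T z).starProjection b - m)]
    exact norm_sub_le _ _
  rw [dist_eq_norm] at hd
  have hl2 : ℓ ^ 2 / (2 * τ) ≤ η * ℓ / τ := by
    rw [div_le_div_iff₀ (by positivity) hτ]
    nlinarith [mul_nonneg (mul_nonneg hτ.le (norm_nonneg (z' - z))) (sub_nonneg.2 hℓη)]
  have h2 : ‖z + (T z).starProjection b - m‖ ≤ η * ℓ / τ := by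
    refine hd.trans (le_trans ?_ hl2)
    gcongr
    exact ((T z).norm_starProjection_apply_le b).trans hbl
  have h3 : ‖(T z)ᗮ.starProjection b‖ ≤ 2 * (η * ℓ / τ) := by
    have h4 := (h.norm_starProjection_orthogonal_le hz hz').trans hl2
    have h5 : ‖(T z)ᗮ.starProjection e‖ ≤ 3 / 2 * (η * ℓ / τ) := by
      refine (h.norm_starProjection_orthogonal_tangent_le hz hz₀
        (by rw [norm_sub_rev]; linarith) he).trans ?_
      rw [hel, norm_sub_rev, ← mul_div_assoc, ← mul_assoc]
      gcongr
    rw [hb, map_smul, map_add, norm_smul, Real.norm_of_nonneg (by norm_num)]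
    have := norm_add_le ((T z)ᗮ.starProjection (z' - z)) ((T z)ᗮ.starProjection e)
    have h0 : 0 ≤ η * ℓ / τ := le_trans (by positivity) hl2
    linarith
  calc _ ≤ η * ℓ / τ + 2 * (η * ℓ / τ) := h1.trans (add_le_add h2 h3)
    _ = _ := by ring

/-- For tangent vectors `e` at a nearby point, normal vectors vary in the direction of `e` with
Lipschitz constant `σ / τ`, up to an error that vanishes locally. -/
theorem inner_normal_sub_le (h : HasReachGeometry M τ T) {z₀ z z' n n' e : E} {η σ : ℝ}
    (hz₀ : z₀ ∈ M) (hz : z ∈ M) (hz' : z' ∈ M) (hzη : ‖z - z₀‖ ≤ η) (hzη' : ‖z' - z₀‖ ≤ η)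
    (hητ : 6 * η ≤ τ) (hστ : σ ≤ τ) (hn : n ∈ (T z)ᗮ) (hn' : n' ∈ (T z')ᗮ)
    (hnσ : ‖n‖ ≤ σ) (hnσ' : ‖n'‖ ≤ σ) (heT : e ∈ T z₀) (hel : ‖e‖ = ‖z' - z‖) :
    τ * ⟪e, n - n'⟫_ℝ ≤ ‖z' - z‖ * (σ * ‖z' - z‖ + 18 * η * ‖z' - z‖ + 6 * η * ‖n - n'‖) := by
  have hτ := h.pos
  have hη0 : 0 ≤ η := (norm_nonneg _).trans hzη
  have hσ0 : 0 ≤ σ := (norm_nonneg _).trans hnσ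
  -- The difference `m₁ - m₂` is close to `e`, and by the parallelogram law the squared distances of
  -- `m₁`, `m₂` to `z`, and likewise to `z'`, sum to about `‖z' - z‖²`. The four-point inequality
  -- then gives the sharp constant `σ`.
  obtain ⟨m₁, hm₁, hd₁⟩ := h.exists_norm_sub_midpoint_le hz₀ hz hz' hzη hzη' (by linarith) heT hel
  obtain ⟨m₂, hm₂, hd₂⟩ := h.exists_norm_sub_midpoint_le hz₀ hz hz' hzη hzη' (by linarith)
    ((T z₀).neg_mem heT) (by rw [norm_neg, hel])
  have hm := h.inner_sub_normal_le hz hz' hm₁ hm₂ hn hn' hnσ hnσ'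
  have hek : ⟪e, n - n'⟫_ℝ ≤ ⟪m₁ - m₂, n - n'⟫_ℝ + 2 * (3 * η / τ * ‖z' - z‖) * ‖n - n'‖ := by
    set b₁ := m₁ - (z + (1 / 2 : ℝ) • (z' - z + e)) with hb₁
    set b₂ := m₂ - (z + (1 / 2 : ℝ) • (z' - z + -e)) with hb₂
    have e1 : m₁ - m₂ - e = b₁ - b₂ := by rw [hb₁, hb₂]; module
    have h1 := real_inner_le_norm (-(b₁ - b₂)) (n - n')
    rw [norm_neg, inner_neg_left, ← e1, inner_sub_left (m₁ - m₂), e1] at h1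
    have h2 : ‖b₁ - b₂‖ ≤ 2 * (3 * η / τ * ‖z' - z‖) := (norm_sub_le _ _).trans (by linarith)
    have := mul_le_mul_of_nonneg_right h2 (norm_nonneg (n - n'))
    linarith
  have q : ‖m₁ - z‖ ^ 2 + ‖m₂ - z‖ ^ 2 ≤
      ‖z' - z‖ ^ 2 + 6 * ‖z' - z‖ * (3 * η / τ * ‖z' - z‖) := by
    refine norm_sq_add_norm_sq_le_of_near rfl hel ?_ (by rwa [sub_sub]) (by rwa [sub_sub])
    refine mul_le_of_le_one_left (norm_nonneg _) ?_
    rw [div_le_one hτ]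
    linarith
  have q' : ‖m₁ - z'‖ ^ 2 + ‖m₂ - z'‖ ^ 2 ≤
      ‖z' - z‖ ^ 2 + 6 * ‖z' - z‖ * (3 * η / τ * ‖z' - z‖) := by
    refine norm_sq_add_norm_sq_le_of_near (v := z - z') (norm_sub_rev _ _) hel ?_ ?_ ?_
    · refine mul_le_of_le_one_left (norm_nonneg _) ?_
      rw [div_le_one hτ]
      linarith
    · convert hd₁ using 2
      module
    · convert hd₂ using 2
      module
  set ℓ := ‖z' - z‖
  set κ := ‖n - n'‖
  have hℓ0 : 0 ≤ ℓ := norm_nonneg _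
  have hτε : τ * (3 * η / τ * ℓ) = 3 * η * ℓ := by field_simp
  set ε := 3 * η / τ * ℓ
  have hε0 : 0 ≤ ε := by positivity
  have h1 : σ * ε ≤ 3 * η * ℓ := hτε ▸ mul_le_mul_of_nonneg_right hστ hε0
  have h2 : σ * ((‖m₁ - z‖ ^ 2 + ‖m₂ - z‖ ^ 2) + (‖m₁ - z'‖ ^ 2 + ‖m₂ - z'‖ ^ 2)) ≤
      σ * (2 * (ℓ ^ 2 + 6 * ℓ * ε)) := mul_le_mul_of_nonneg_left (by linarith) hσ0
  have h3 := mul_le_mul_of_nonneg_left hek hτ.le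
  have h4 : τ * (2 * ε * κ) = 6 * η * ℓ * κ := by
    calc τ * (2 * ε * κ) = 2 * (τ * ε) * κ := by ring
      _ = _ := by rw [hτε]; ring
  have h5 := mul_le_mul_of_nonneg_left h1 hℓ0
  linarith

/-- Slices of a tube around `M` by translates of a nearby tangent space are at most `1 + σ / τ`
times as large as the part of `M` over which they lie, up to an error that vanishes locally. -/
theorem norm_add_normal_sub_le (h : HasReachGeometry M τ T) {z₀ z z' n n' : E} {η σ : ℝ}
    (hz₀ : z₀ ∈ M) (hz : z ∈ M) (hz' : z' ∈ M) (hzη : ‖z - z₀‖ ≤ η) (hzη' : ‖z' - z₀‖ ≤ η)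
    (hητ : 6 * η ≤ τ) (hστ : σ ≤ τ) (hn : n ∈ (T z)ᗮ) (hn' : n' ∈ (T z')ᗮ)
    (hnσ : ‖n‖ ≤ σ) (hnσ' : ‖n'‖ ≤ σ) (hΔ : z + n - (z' + n') ∈ T z₀) :
    (τ - 6 * η) * ‖z + n - (z' + n')‖ ≤ (τ + σ + 24 * η) * ‖z - z'‖ := by
  have hτ := h.pos
  have hη0 : 0 ≤ η := (norm_nonneg _).trans hzη
  have hσ0 : 0 ≤ σ := (norm_nonneg _).trans hnσ
  set Δ := z + n - (z' + n') with hΔd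
  set ℓ := ‖z' - z‖ with hℓ
  rw [norm_sub_rev z z', ← hℓ]
  have hℓ0 : 0 ≤ ℓ := norm_nonneg _
  rcases eq_or_ne Δ 0 with h0 | h0
  · rw [h0, norm_zero, mul_zero]; positivity
  have hΔ0 : 0 < ‖Δ‖ := norm_pos_iff.2 h0
  have hΔk : Δ = (z - z') + (n - n') := by rw [hΔd]; abel
  rcases hℓ0.eq_or_lt with hl | hl
  · have hzz : z' = z := by rw [← sub_eq_zero, ← norm_eq_zero, ← hℓ, ← hl]
    subst hzz
    have hΔN : Δ ∈ (T z')ᗮ := by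
      rw [hΔk, sub_self, zero_add]; exact Submodule.sub_mem _ hn hn'
    have h1 := h.inner_le_mul_norm hz' hz₀ (by rw [norm_sub_rev]; linarith) hΔN hΔ
    rw [real_inner_self_eq_norm_sq, norm_sub_rev z₀] at h1
    rw [← hl, mul_zero]
    have h2 : τ * ‖Δ‖ ^ 2 ≤ 3 / 2 * η * ‖Δ‖ * ‖Δ‖ := h1.trans (by gcongr)
    have h3 : τ * ‖Δ‖ ≤ 3 / 2 * η * ‖Δ‖ := by
      refine le_of_mul_le_mul_right ?_ hΔ0
      linarith
    nlinarith
  set k := n - n' with hk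
  -- `Δ` rescaled to the length of the chord, as `inner_normal_sub_le` requires.
  set e := (ℓ / ‖Δ‖) • Δ with he
  have heT : e ∈ T z₀ := (T z₀).smul_mem _ hΔ
  have hel : ‖e‖ = ℓ := by
    rw [he, norm_smul, Real.norm_of_nonneg (by positivity), div_mul_cancel₀ _ hΔ0.ne']
  have hv' : ‖z - z'‖ = ℓ := norm_sub_rev z z'
  have hkn : ‖k‖ ≤ ‖Δ‖ + ℓ := by
    have : k = Δ - (z - z') := by rw [hΔk]; abel
    rw [this, ← hv']
    exact norm_sub_le _ _
  have hfin : τ * ⟪e, k⟫_ℝ ≤ ℓ * (σ * ℓ + 24 * η * ℓ + 6 * η * ‖Δ‖) := by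
    refine (h.inner_normal_sub_le hz₀ hz hz' hzη hzη' hητ hστ hn hn' hnσ hnσ' heT hel).trans ?_
    rw [← hℓ, ← hk]
    refine mul_le_mul_of_nonneg_left ?_ hℓ0
    nlinarith
  have hΔe : ℓ * ⟪Δ, k⟫_ℝ = ‖Δ‖ * ⟪e, k⟫_ℝ := by
    rw [he, real_inner_smul_left]; field_simp
  have hΔk' : τ * ⟪Δ, k⟫_ℝ ≤ ‖Δ‖ * (σ * ℓ + 24 * η * ℓ + 6 * η * ‖Δ‖) := by
    refine le_of_mul_le_mul_left ?_ hl
    calc ℓ * (τ * ⟪Δ, k⟫_ℝ) = ‖Δ‖ * (τ * ⟪e, k⟫_ℝ) := by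
          rw [mul_left_comm, hΔe]; ring
      _ ≤ ‖Δ‖ * (ℓ * (σ * ℓ + 24 * η * ℓ + 6 * η * ‖Δ‖)) := by gcongr
      _ = _ := by ring
  -- Only the component of `k` along `Δ` matters, which is why bounding `k` in tangent directions
  -- suffices.
  have hΔsq : ‖Δ‖ ^ 2 ≤ ‖Δ‖ * ℓ + ⟪Δ, k⟫_ℝ := by
    have h1 : ‖Δ‖ ^ 2 = ⟪Δ, z - z'⟫_ℝ + ⟪Δ, k⟫_ℝ := by
      rw [← inner_add_right, ← hΔk, real_inner_self_eq_norm_sq]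
    have h2 := real_inner_le_norm Δ (z - z')
    rw [hv'] at h2
    linarith
  refine le_of_mul_le_mul_left ?_ hΔ0
  nlinarith [mul_le_mul_of_nonneg_left hΔsq hτ.le]

end HasReachGeometry

/-! ### Comparison of Hausdorff measures -/

section HausdorffComparison

theorem euclideanHausdorffMeasure_image_le_of_lipschitzOnWith {X Y : Type*} [EMetricSpace X]
    [MeasurableSpace X] [BorelSpace X] [EMetricSpace Y] [MeasurableSpace Y] [BorelSpace Y]
    {f : X → Y} {s : Set X} {c : ℝ≥0} (hf : LipschitzOnWith c f s) (d : ℕ) :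
    μHE[d] (f '' s) ≤ (c : ℝ≥0∞) ^ d * μHE[d] s := by
  have := hf.hausdorffMeasure_image_le (d := d) (by positivity)
  rw [ENNReal.rpow_natCast] at this
  simp only [Measure.euclideanHausdorffMeasure_def, Measure.smul_apply, ENNReal.smul_def,
    smul_eq_mul]
  rw [mul_left_comm]
  gcongr

/-- A comparison of Hausdorff measures along a relation which expands distances by a factor at
least `c⁻¹`. -/
theorem euclideanHausdorffMeasure_le_of_rel {X Y : Type*} [MetricSpace X] [MeasurableSpace X]
    [BorelSpace X] [MetricSpace Y] [MeasurableSpace Y] [BorelSpace Y] {S : Set X} {A : Set Y}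
    {c : ℝ≥0} (R : X → Y → Prop) (hex : ∀ x ∈ S, ∃ y ∈ A, R x y)
    (hR : ∀ x ∈ S, ∀ x' ∈ S, ∀ y ∈ A, ∀ y' ∈ A, R x y → R x' y' → dist x x' ≤ c * dist y y')
    (d : ℕ) : μHE[d] S ≤ (c : ℝ≥0∞) ^ d * μHE[d] A := by
  rcases S.eq_empty_or_nonempty with rfl | ⟨x₀, hx₀⟩
  · simp
  have : Nonempty X := ⟨x₀⟩
  have : Nonempty Y := ⟨(hex x₀ hx₀).choose⟩
  choose! g hgA hgR using hex
  -- The choice function `g` need not be continuous, but its inverse on the image is `c`-Lipschitz.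
  have hinj : InjOn g S := by
    intro x hx x' hx' he
    have := hR x hx x' hx' _ (hgA x hx) _ (hgA x' hx') (hgR x hx) (hgR x' hx')
    rw [he, dist_self, mul_zero] at this
    exact dist_le_zero.1 this
  have hleft := hinj.leftInvOn_invFunOn
  have hlip : LipschitzOnWith c (Function.invFunOn g S) (g '' S) := by
    refine LipschitzOnWith.of_dist_le_mul ?_
    rintro _ ⟨x, hx, rfl⟩ _ ⟨x', hx', rfl⟩
    rw [hleft hx, hleft hx']
    exact hR x hx x' hx' _ (hgA x hx) _ (hgA x' hx') (hgR x hx) (hgR x' hx')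
  calc μHE[d] S = μHE[d] (Function.invFunOn g S '' (g '' S)) := by rw [hleft.image_image]
    _ ≤ (c : ℝ≥0∞) ^ d * μHE[d] (g '' S) :=
      euclideanHausdorffMeasure_image_le_of_lipschitzOnWith hlip d
    _ ≤ _ := by
      gcongr
      exact image_subset_iff.2 hgA

end HausdorffComparison

/-! ### Slicing by a subspace and its orthogonal complement -/

section Slicing

variable {E : Type*} [NormedAddCommGroup E] [InnerProductSpace ℝ E] [FiniteDimensional ℝ E]
  [MeasurableSpace E] [BorelSpace E]

theorem Submodule.measurePreserving_volume_measurableEquivProd (K : Submodule ℝ E) (p : E) :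
    MeasurePreserving (K.measurableEquivProd p) (volume : Measure E)
      ((volume : Measure K).prod (volume : Measure Kᗮ)) := by
  have := K.measurePreserving_measurableEquivProd p
  rwa [InnerProductSpace.euclideanHausdorffMeasure_eq_volume] at this

theorem volume_eq_lintegral_slice (K : Submodule ℝ E) (p : E) {B : Set E} (hB : MeasurableSet B) :
    volume B = ∫⁻ a : K, volume {b : Kᗮ | p + a + b ∈ B} := by
  have h1 := (K.measurePreserving_volume_measurableEquivProd p).symm.measure_preimage_equiv B
  rw [← h1, Measure.prod_apply ((K.measurableEquivProd p).symm.measurable hB)]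
  congr with a
  congr 1
  ext b
  simp [add_comm, add_left_comm]

theorem volume_eq_lintegral_slice' (K : Submodule ℝ E) (p : E) {B : Set E}
    (hB : MeasurableSet B) :
    volume B = ∫⁻ b : Kᗮ, volume {a : K | p + a + b ∈ B} := by
  have h1 := (K.measurePreserving_volume_measurableEquivProd p).symm.measure_preimage_equiv B
  rw [← h1, Measure.prod_apply_symm ((K.measurableEquivProd p).symm.measurable hB)]
  congr with b
  congr 1
  ext a
  simp [add_comm, add_left_comm]

/-- The volume of a ball only depends on the dimension. -/
theorem volume_ball_eq_euclideanSpace {k : ℕ} (hk : Module.finrank ℝ E = k) (x : E) (r : ℝ) :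
    volume (ball x r) = volume (ball (0 : EuclideanSpace ℝ (Fin k)) r) := by
  subst hk
  rw [← (stdOrthonormalBasis ℝ E).measurePreserving_repr.measure_preimage
    measurableSet_ball.nullMeasurableSet]
  rw [Measure.addHaar_ball_center]
  congr 1
  ext y
  simp

end Slicing

/-! ### Volumes of tubes and of pieces of `M` -/

namespace HasReachGeometry

variable {E : Type*} [NormedAddCommGroup E] [InnerProductSpace ℝ E] [FiniteDimensional ℝ E]
  [MeasurableSpace E] [BorelSpace E] {M : Set E} {τ : ℝ} {T : E → Submodule ℝ E} {d k : ℕ}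

/-- The volume of a tube over a small part of `M`. -/
theorem volume_tube_le_local (h : HasReachGeometry M τ T) {z₀ : E} {η σ : ℝ} (hz₀ : z₀ ∈ M)
    (hd : Module.finrank ℝ (T z₀) = d) (hk : Module.finrank ℝ (T z₀)ᗮ = k) 
    (hητ : 6 * η < τ) (hστ : σ ≤ τ) {A B : Set E}
    (hA : A ⊆ M ∩ closedBall z₀ η) (hB : MeasurableSet B)
    (hBA : ∀ x ∈ B, ∃ z ∈ A, dist x z = infDist x M ∧ dist x z < σ) :
    volume B ≤ ENNReal.ofReal ((τ + σ + 24 * η) / (τ - 6 * η)) ^ d *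
      volume (ball (0 : EuclideanSpace ℝ (Fin k)) (σ + η)) * μHE[d] A := by
  have hτ := h.pos
  set c : ℝ≥0 := Real.toNNReal ((τ + σ + 24 * η) / (τ - 6 * η)) with hc
  -- Send a point of the slice to its nearest point in `A`: distances shrink at most by the factor
  -- of `norm_add_normal_sub_le`. Slices at height `σ + η` or more are empty.
  have hslice : ∀ b : (T z₀)ᗮ, volume {a : T z₀ | z₀ + a + b ∈ B} ≤
      (ball (0 : (T z₀)ᗮ) (σ + η)).indicator (fun _ => (c : ℝ≥0∞) ^ d * μHE[d] A) b := by
    intro b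
    by_cases hb : b ∈ ball (0 : (T z₀)ᗮ) (σ + η)
    · rw [indicator_of_mem hb, ← InnerProductSpace.euclideanHausdorffMeasure_eq_volume, hd]
      refine euclideanHausdorffMeasure_le_of_rel
        (fun (a : T z₀) z => dist (z₀ + a + b) z = infDist (z₀ + a + b) M ∧
          dist (z₀ + a + b) z < σ) (fun a ha => hBA _ ha) ?_ d
      rintro a - a' - z hz z' hz' ⟨hn, hnσ⟩ ⟨hn', hnσ'⟩
      have hzM := hA hz
      have hzM' := hA hz'
      have hη0 : 0 ≤ η := dist_nonneg.trans hzM.2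
      have hσ0 : 0 < σ := dist_nonneg.trans_lt hnσ
      have e1 : z + (z₀ + a + b - z) - (z' + (z₀ + a' + b - z')) = ((a - a' : T z₀) : E) := by
        push_cast; abel
      have := h.norm_add_normal_sub_le hz₀ hzM.1 hzM'.1 (by rw [← dist_eq_norm]; exact hzM.2)
        (by rw [← dist_eq_norm]; exact hzM'.2) hητ.le hστ
        (h.sub_mem_orthogonal _ z hzM.1 hn) (h.sub_mem_orthogonal _ z' hzM'.1 hn')
        (by rw [← dist_eq_norm]; exact hnσ.le) (by rw [← dist_eq_norm]; exact hnσ'.le)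
        (by rw [e1]; exact Submodule.coe_mem _)
      rw [e1, ← Submodule.coe_norm, ← dist_eq_norm, ← dist_eq_norm] at this
      rw [hc, Real.coe_toNNReal _ (div_nonneg (by positivity) (by linarith)),
        div_mul_eq_mul_div, le_div_iff₀ (by linarith)]
      linarith
    · rw [indicator_of_notMem hb]
      have : {a : T z₀ | z₀ + a + b ∈ B} = ∅ := by
        refine eq_empty_of_forall_notMem fun a ha => hb ?_
        obtain ⟨z, hz, -, hzσ⟩ := hBA _ ha
        rw [mem_ball_zero_iff]
        have h1 : dist (z₀ + a + b) z₀ < σ + η :=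
          (dist_triangle _ z _).trans_lt (add_lt_add_of_lt_of_le hzσ (hA hz).2)
        refine lt_of_le_of_lt ?_ h1
        rw [dist_eq_norm, add_assoc, add_sub_cancel_left]
        have h2 := norm_add_sq_eq_norm_sq_add_norm_sq_real
          (Submodule.inner_right_of_mem_orthogonal a.2 b.2)
        rw [Submodule.coe_norm]
        nlinarith [norm_nonneg (a : E), norm_nonneg (b : E), norm_nonneg ((a : E) + b)]
      rw [this, measure_empty]
  calc volume B = ∫⁻ b : (T z₀)ᗮ, volume {a : T z₀ | z₀ + a + b ∈ B} :=
        volume_eq_lintegral_slice' _ _ hB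
    _ ≤ ∫⁻ b : (T z₀)ᗮ, (ball (0 : (T z₀)ᗮ) (σ + η)).indicator
          (fun _ => (c : ℝ≥0∞) ^ d * μHE[d] A) b := lintegral_mono hslice
    _ = _ := by
      rw [lintegral_indicator_const measurableSet_ball, volume_ball_eq_euclideanSpace hk]
      rw [ENNReal.ofReal, ← hc]
      ring

/-- `M` is Lipschitz over its tangent space near `y`. -/
theorem euclideanHausdorffMeasure_inter_closedBall_le (h : HasReachGeometry M τ T) {y : E} {r : ℝ}
    (hy : y ∈ M) (hd : Module.finrank ℝ (T y) = d) (hr0 : 0 ≤ r) (hr : 2 * r < τ) :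
    μHE[d] (M ∩ closedBall y r) ≤ ENNReal.ofReal (√(1 - (2 * r / τ) ^ 2))⁻¹ ^ d *
      volume (closedBall (0 : T y) r) := by
  have hτ := h.pos
  have hlt : 0 < 1 - (2 * r / τ) ^ 2 := by
    have : 2 * r / τ < 1 := by rwa [div_lt_one hτ]
    nlinarith [div_nonneg (by linarith : 0 ≤ 2 * r) hτ.le]
  rw [← InnerProductSpace.euclideanHausdorffMeasure_eq_volume, hd, ENNReal.ofReal]
  refine euclideanHausdorffMeasure_le_of_rel
    (fun z a => (T y).orthogonalProjectionOnto (z - y) = a) ?_ ?_ d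
  · rintro z ⟨hz, hzr⟩
    refine ⟨_, ?_, rfl⟩
    rw [mem_closedBall_zero_iff]
    refine ((T y).norm_orthogonalProjectionOnto_apply_le _).trans ?_
    rw [← dist_eq_norm]
    exact hzr
  · rintro z ⟨hz, hzr⟩ z' ⟨hz', hzr'⟩ _ - _ - rfl rfl
    rw [mem_closedBall, dist_eq_norm] at hzr hzr'
    rw [dist_eq_norm, dist_eq_norm, ← map_sub, sub_sub_sub_cancel_right,
      Real.coe_toNNReal _ (by positivity), inv_mul_eq_div, le_div_iff₀ (Real.sqrt_pos.2 hlt)]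
    -- A chord has normal part at most `2r / τ` times its length, so projecting to `T y` keeps at
    -- least the fraction `√(1 - (2r / τ)²)`.
    have h1 := h.norm_starProjection_orthogonal_chord_le hy hz' hz hzr' hzr (by linarith)
    have h2 := Submodule.norm_sq_eq_add_norm_sq_starProjection (z - z') (T y)
    rw [Submodule.coe_norm, ← Submodule.starProjection_apply]
    refine le_of_sq_le_sq ?_ (norm_nonneg _)
    rw [mul_pow, Real.sq_sqrt hlt.le]
    have h3 := pow_le_pow_left₀ (norm_nonneg _) h1 2
    rw [mul_pow] at h3
    linarith

/-- The tube around `M` is not thin over the tangent space at `y`. -/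
theorem volume_mul_le_volume_thickening (h : HasReachGeometry M τ T) {y : E} {s σ : ℝ}
    (hy : y ∈ M) (hk : Module.finrank ℝ (T y)ᗮ = k) (hs : 0 < s) (hsτ : s ≤ τ / 2)
    {S : Set (T y)} (hS : MeasurableSet S) (hSs : S ⊆ ball 0 (s * √(1 - (s / (2 * τ)) ^ 2))) :
    volume (ball (0 : EuclideanSpace ℝ (Fin k)) σ) * volume S ≤
      volume (thickening σ M ∩ ball y (s + σ) ∩
        (fun x => (T y).orthogonalProjectionOnto (x - y)) ⁻¹' S) := by
  have hmeas : MeasurableSet (thickening σ M ∩ ball y (s + σ) ∩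
      (fun x => (T y).orthogonalProjectionOnto (x - y)) ⁻¹' S) :=
    (isOpen_thickening.measurableSet.inter measurableSet_ball).inter
      (hS.preimage (by fun_prop))
  rw [volume_eq_lintegral_slice (T y) y hmeas, ← lintegral_indicator_const hS]
  refine lintegral_mono fun a => ?_
  by_cases ha : a ∈ S
  · rw [indicator_of_mem ha]
    -- Over `a` lies a point `m` of `M`, and the fibre over `a` contains the ball of radius `σ`
    -- about `m`.
    obtain ⟨m, hm, hms, hma⟩ := h.exists_starProjection_eq hy a.2 hs hsτ
      (by simpa using hSs ha)
    rw [← volume_ball_eq_euclideanSpace hk ((T y)ᗮ.orthogonalProjectionOnto (m - y))]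
    refine measure_mono fun b hb => ?_
    rw [mem_ball, dist_eq_norm] at hb
    have e1 : y + a + b - m =
        ((b - (T y)ᗮ.orthogonalProjectionOnto (m - y) : (T y)ᗮ) : E) := by
      have := (T y).starProjection_add_starProjection_orthogonal (m - y)
      rw [hma] at this
      push_cast
      rw [← Submodule.starProjection_apply, ← sub_eq_zero]
      have h2 : m = y + (a + (T y)ᗮ.starProjection (m - y)) := by rw [this]; abel
      conv_lhs => enter [1, 2]; rw [h2]
      abel
    have hdist : dist (y + a + b) m < σ := by
      rw [dist_eq_norm, e1]; exact hb
    refine ⟨⟨mem_thickening_iff.2 ⟨m, hm, hdist⟩, ?_⟩, ?_⟩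
    · rw [mem_ball]
      have := dist_triangle (y + a + b) m y
      rw [dist_eq_norm m y] at this
      linarith
    · have : (T y).orthogonalProjectionOnto (y + a + b - y) = a := by
        rw [add_assoc, add_sub_cancel_left, map_add,
          Submodule.orthogonalProjectionOnto_mem_subspace_eq_self,
          Submodule.orthogonalProjectionOnto_apply_of_mem_orthogonal b.2,
          add_zero]
      exact mem_preimage.2 (this.symm ▸ ha)
  · rw [indicator_of_notMem ha]
    exact zero_le

/-- The noiseless counterpart of `volume_mul_le_volume_thickening`: orthogonal projection is
1-Lipschitz and maps this piece of `M` onto `S`. -/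
theorem euclideanHausdorffMeasure_le_inter (h : HasReachGeometry M τ T) {y : E} {s : ℝ}
    (hy : y ∈ M) (hd : Module.finrank ℝ (T y) = d) (hs : 0 < s) (hsτ : s ≤ τ / 2)
    {S : Set (T y)} (hSs : S ⊆ ball 0 (s * √(1 - (s / (2 * τ)) ^ 2))) :
    volume S ≤ μHE[d] (M ∩ ball y s ∩
      (fun x => (T y).orthogonalProjectionOnto (x - y)) ⁻¹' S) := by
  rw [← InnerProductSpace.euclideanHausdorffMeasure_eq_volume, hd]
  have hlip : LipschitzWith 1 (fun x => (T y).orthogonalProjectionOnto (x - y)) := by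
    refine LipschitzWith.of_dist_le_mul fun a b => ?_
    rw [dist_eq_norm, ← map_sub, sub_sub_sub_cancel_right, NNReal.coe_one, one_mul, dist_eq_norm]
    exact (T y).norm_orthogonalProjectionOnto_apply_le _
  refine le_trans (measure_mono ?_) ((euclideanHausdorffMeasure_image_le_of_lipschitzOnWith
    (hlip.lipschitzOnWith (s := M ∩ ball y s ∩
      (fun x => (T y).orthogonalProjectionOnto (x - y)) ⁻¹' S)) d).trans_eq (by simp))
  intro a ha
  obtain ⟨m, hm, hms, hma⟩ := h.exists_starProjection_eq hy a.2 hs hsτ (by simpa using hSs ha)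
  have hma' : (T y).orthogonalProjectionOnto (m - y) = a := Subtype.ext hma
  exact ⟨m, ⟨⟨hm, by rwa [mem_ball, dist_eq_norm]⟩, mem_preimage.2 (hma'.symm ▸ ha)⟩, hma'⟩

end HasReachGeometry

/-- The nearest point projection is measurable on a tube where nearest points are unique. -/
theorem exists_measurable_nearest {E : Type*} [MetricSpace E] [MeasurableSpace E] [BorelSpace E]
    {M : Set E} (hM : IsCompact M) (hne : M.Nonempty) {σ : ℝ}
    (hU : ∀ x, infDist x M < σ → ∃! m, m ∈ M ∧ dist x m = infDist x M) :
    ∃ π : E → E, Measurable π ∧ ∀ x, infDist x M < σ → π x ∈ M ∧ dist x (π x) = infDist x M := by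
  classical
  choose π hπM hπ using fun x => hM.exists_infDist_eq_dist hne x
  have hopen : IsOpen {x | infDist x M < σ} := isOpen_lt (continuous_infDist_pt M) continuous_const
  have hcont : ContinuousOn π {x | infDist x M < σ} := by
    refine Metric.continuousOn_iff.2 fun x hx ε hε => ?_
    obtain ⟨m, -, hm⟩ := hU x hx
    obtain ⟨δ, hδ, h⟩ := hM.exists_forall_dist_nearest_lt (x := x) (m := π x)
      (fun z hz hzd => (hm z ⟨hz, hzd⟩).trans (hm _ ⟨hπM x, (hπ x).symm⟩).symm) hε
    exact ⟨δ, hδ, fun x' _ hx' => h x' (π x') hx' (hπM x') (hπ x').symm⟩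
  -- Beyond the tube nearest points need not be unique and the choice may fail to be measurable, so
  -- a constant replaces it there.
  refine ⟨{x | infDist x M < σ}.piecewise π fun _ => hne.some,
    hcont.measurable_piecewise continuousOn_const hopen.measurableSet, fun x hx => ?_⟩
  rw [piecewise_eq_of_mem {x | infDist x M < σ} _ _ hx]
  exact ⟨hπM x, (hπ x).symm⟩

namespace HasReachGeometry

section

variable {E : Type*} [NormedAddCommGroup E] [InnerProductSpace ℝ E] [FiniteDimensional ℝ E]
  [MeasurableSpace E] [BorelSpace E] {M : Set E} {τ : ℝ} {T : E → Submodule ℝ E} {d k : ℕ}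

/-- Cut `A` along a finite cover of `M` by balls of radius `η`, and cut `B` accordingly by the
nearest point projection. The local estimate has the same constant for every piece, so the pieces
add up. -/
theorem volume_tube_le_of_pos (h : HasReachGeometry M τ T)
    (hU : ∀ x, infDist x M < τ → ∃! m, m ∈ M ∧ dist x m = infDist x M)
    (hd : ∀ z ∈ M, Module.finrank ℝ (T z) = d) (hk : ∀ z ∈ M, Module.finrank ℝ (T z)ᗮ = k)
    {η σ : ℝ} (hη : 0 < η) (hητ : 6 * η < τ) (hστ : σ ≤ τ) {A B : Set E}
    (hAM : A ⊆ M) (hA : MeasurableSet A) (hB : MeasurableSet B)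
    (hBA : ∀ x ∈ B, ∃ z ∈ A, dist x z = infDist x M ∧ dist x z < σ) :
    volume B ≤ ENNReal.ofReal ((τ + σ + 24 * η) / (τ - 6 * η)) ^ d *
      volume (ball (0 : EuclideanSpace ℝ (Fin k)) (σ + η)) * μHE[d] A := by
  rcases B.eq_empty_or_nonempty with rfl | ⟨x₀, hx₀⟩
  · simp
  have hne : M.Nonempty := ⟨_, hAM (hBA x₀ hx₀).choose_spec.1⟩
  obtain ⟨π, hπm, hπ⟩ := exists_measurable_nearest h.isCompact hne hU
  have hBτ : ∀ x ∈ B, infDist x M < τ := fun x hx => by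
    obtain ⟨z, -, h1, h2⟩ := hBA x hx
    exact h1 ▸ h2.trans_le hστ
  have hBσ : ∀ x ∈ B, dist x (π x) < σ := fun x hx => by
    obtain ⟨z, -, h1, h2⟩ := hBA x hx
    rw [(hπ x (hBτ x hx)).2, ← h1]
    exact h2
  have hBπ : B = B ∩ π ⁻¹' A := by
    refine subset_antisymm (fun x hx => ⟨hx, ?_⟩) inter_subset_left
    obtain ⟨z, hz, h1, -⟩ := hBA x hx
    have : π x = z := (hU x (hBτ x hx)).unique (hπ x (hBτ x hx)) ⟨hAM hz, h1⟩
    exact mem_preimage.2 (this.symm ▸ hz)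
  set C := ENNReal.ofReal ((τ + σ + 24 * η) / (τ - 6 * η)) ^ d *
      volume (ball (0 : EuclideanSpace ℝ (Fin k)) (σ + η)) with hC
  obtain ⟨t, htM, ht⟩ := h.isCompact.elim_nhds_subcover (fun z => closedBall z η)
    fun z _ => closedBall_mem_nhds z hη
  have key : ∀ t : Finset E, (∀ z ∈ t, z ∈ M) → ∀ A : Set E, MeasurableSet A → A ⊆ M →
      A ⊆ ⋃ z ∈ t, closedBall z η → volume (B ∩ π ⁻¹' A) ≤ C * μHE[d] A := by
    classical
    intro t
    induction t using Finset.induction_on with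
    | empty =>
      intro _ A _ _ hA
      have : A = ∅ := by simpa [subset_empty_iff] using hA
      simp [this]
    | insert z t hz ih =>
      intro ht A hA hAM hAt
      have hloc : volume (B ∩ π ⁻¹' (A ∩ closedBall z η)) ≤ C * μHE[d] (A ∩ closedBall z η) := by
        refine h.volume_tube_le_local (ht z (Finset.mem_insert_self z t))
          (hd z (ht z (Finset.mem_insert_self z t))) (hk z (ht z (Finset.mem_insert_self z t)))
          hητ hστ (inter_subset_inter_left _ hAM)
          (hB.inter ((hA.inter measurableSet_closedBall).preimage hπm)) ?_
        rintro x ⟨hxB, hxA⟩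
        exact ⟨π x, hxA, (hπ x (hBτ x hxB)).2, hBσ x hxB⟩
      have hrest : volume (B ∩ π ⁻¹' (A \ closedBall z η)) ≤ C * μHE[d] (A \ closedBall z η) := by
        refine ih (fun w hw => ht w (Finset.mem_insert_of_mem hw)) _
          (hA.diff measurableSet_closedBall) (sdiff_subset.trans hAM) ?_
        rintro x ⟨hxA, hxz⟩
        have := hAt hxA
        rw [Finset.set_biUnion_insert] at this
        exact this.resolve_left hxz
      calc volume (B ∩ π ⁻¹' A)
          = volume ((B ∩ π ⁻¹' (A ∩ closedBall z η)) ∪ (B ∩ π ⁻¹' (A \ closedBall z η))) := by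
            rw [← inter_union_distrib_left, ← preimage_union, inter_union_sdiff]
        _ ≤ _ := measure_union_le _ _
        _ ≤ _ := add_le_add hloc hrest
        _ = _ := by rw [← mul_add, measure_inter_add_sdiff _ measurableSet_closedBall]
  rw [hBπ]
  exact key t htM A hA hAM (hAM.trans ht)

/-- The volume of a tube of radius `σ` over a part `A` of `M` is at most `(1 + σ / τ) ^ d` times
the volume of the product of `A` and a normal ball of radius `σ`. -/
theorem volume_tube_le (h : HasReachGeometry M τ T)
    (hU : ∀ x, infDist x M < τ → ∃! m, m ∈ M ∧ dist x m = infDist x M)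
    (hd : ∀ z ∈ M, Module.finrank ℝ (T z) = d) (hk : ∀ z ∈ M, Module.finrank ℝ (T z)ᗮ = k)
    {σ : ℝ} (hσ : 0 < σ) (hστ : σ ≤ τ) {A B : Set E}
    (hAM : A ⊆ M) (hA : MeasurableSet A) (hAfin : μHE[d] A ≠ ∞) (hB : MeasurableSet B)
    (hBA : ∀ x ∈ B, ∃ z ∈ A, dist x z = infDist x M ∧ dist x z < σ) :
    volume B ≤ ENNReal.ofReal (1 + σ / τ) ^ d *
      volume (ball (0 : EuclideanSpace ℝ (Fin k)) σ) * μHE[d] A := by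
  have hτ := h.pos
  set c := volume (ball (0 : EuclideanSpace ℝ (Fin k)) 1) * μHE[d] A with hc
  have hcfin : c ≠ ∞ := ENNReal.mul_ne_top measure_ball_lt_top.ne hAfin
  have hform : ∀ a ρ : ℝ, 0 ≤ a → 0 < ρ → ENNReal.ofReal a ^ d *
      volume (ball (0 : EuclideanSpace ℝ (Fin k)) ρ) * μHE[d] A =
      ENNReal.ofReal (a ^ d * ρ ^ k) * c := by
    intro a ρ ha hρ
    rw [Measure.addHaar_ball_of_pos _ _ hρ, finrank_euclideanSpace_fin, ENNReal.ofReal_mul (by positivity),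
      ENNReal.ofReal_pow ha, hc]
    ring
  have hcont : ContinuousAt (fun η : ℝ =>
      ((τ + σ + 24 * η) / (τ - 6 * η)) ^ d * (σ + η) ^ k) 0 := by
    refine ContinuousAt.mul (ContinuousAt.pow (ContinuousAt.div ?_ ?_ (by simp [hτ.ne'])) d) ?_ <;>
      exact Continuous.continuousAt (by fun_prop)
  have hlim := ENNReal.Tendsto.mul_const (b := c)
    (ENNReal.tendsto_ofReal (hcont.tendsto.mono_left (nhdsWithin_le_nhds (s := Ioi 0))))
    (Or.inr hcfin)
  rw [hform _ _ (by positivity) hσ]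
  -- The bound with `η` holds for all small positive `η`; let `η` tend to zero. Finiteness of the
  -- measure of `A` makes the right side continuous.
  refine ge_of_tendsto (?_ : Tendsto (fun η : ℝ => ENNReal.ofReal
    (((τ + σ + 24 * η) / (τ - 6 * η)) ^ d * (σ + η) ^ k) * c) (𝓝[>] 0) (𝓝 _)) ?_
  · convert hlim using 5
    · simp [add_div, div_self hτ.ne']
    · simp
  · filter_upwards [Ioo_mem_nhdsGT (show (0 : ℝ) < τ / 6 by positivity)] with η hη
    have h6 : 6 * η < τ := by linarith [hη.2]
    have hη0 := hη.1
    rw [← hform _ _ (div_nonneg (by positivity) (by linarith)) (by positivity)]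
    exact h.volume_tube_le_of_pos hU hd hk hη.1 h6 hστ hAM hA hB hBA

end

end HasReachGeometry

theorem measurableSet_tube {D : ℕ} {M : Set (EuclideanSpace ℝ (Fin D))} (hM : IsCompact M)
    (σ : ℝ) : MeasurableSet (tube M σ) := by
  unfold tube
  split_ifs
  · exact hM.measurableSet
  · exact isOpen_thickening.measurableSet

theorem exists_dist_le_of_mem_tube {D : ℕ} {M : Set (EuclideanSpace ℝ (Fin D))} {σ : ℝ}
    {x : EuclideanSpace ℝ (Fin D)} (hx : x ∈ tube M σ) : ∃ z ∈ M, dist x z ≤ σ := by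
  unfold tube at hx
  split_ifs at hx with hσ
  · exact ⟨x, hx, by simp [hσ]⟩
  · obtain ⟨z, hz, hd⟩ := mem_thickening_iff.1 hx
    exact ⟨z, hz, hd.le⟩

/-- Two-sided bounds for the uniform measure on a tube around `M`, compared to Lebesgue measure
on the tangent space at `y`. -/
theorem HasReachGeometry.exists_tube_measure_bounds {D d : ℕ}
    {M : Set (EuclideanSpace ℝ (Fin D))} {τ : ℝ}
    {T : EuclideanSpace ℝ (Fin D) → Submodule ℝ (EuclideanSpace ℝ (Fin D))}
    (h : HasReachGeometry M τ T)
    (hU : ∀ x, infDist x M < τ → ∃! m, m ∈ M ∧ dist x m = infDist x M)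
    (hd : ∀ z ∈ M, Module.finrank ℝ (T z) = d) {σ s r : ℝ} (hσ : 0 ≤ σ)
    (hs : 0 < s) (hsτ : s ≤ τ / 2) (hr0 : 0 ≤ r) (hrτ : 2 * (r + σ) < τ)
    {y : EuclideanSpace ℝ (Fin D)} (hy : y ∈ M) :
    ∃ κ : ℝ≥0∞, κ ≠ 0 ∧ κ ≠ ∞ ∧
      (if σ = 0 then Measure.hausdorffMeasure (d : ℝ) else volume) (tube M σ ∩ closedBall y r) ≤
        κ * (ENNReal.ofReal ((1 + σ / τ) * (√(1 - (2 * (r + σ) / τ) ^ 2))⁻¹) ^ d *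
          volume (closedBall (0 : T y) (r + σ))) ∧
      ∀ S : Set (T y), MeasurableSet S → S ⊆ ball 0 (s * √(1 - (s / (2 * τ)) ^ 2)) →
        κ * volume S ≤ (if σ = 0 then Measure.hausdorffMeasure (d : ℝ) else volume)
          (tube M σ ∩ ball y (s + σ) ∩
            (fun x => (T y).orthogonalProjectionOnto (x - y)) ⁻¹' S) := by
  have hτ := h.pos
  have hMr := h.euclideanHausdorffMeasure_inter_closedBall_le hy (hd y hy) (by positivity) hrτ
  rcases hσ.eq_or_lt with rfl | hσ0
  · have ha0 := Measure.addHaarScalarFactor_volume_hausdorffMeasure_ne_zero d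
    set a := Measure.addHaarScalarFactor (volume : Measure (EuclideanSpace ℝ (Fin d))) μH[d]
      with ha
    have hsc : ∀ X : Set (EuclideanSpace ℝ (Fin D)), μH[d] X = (a : ℝ≥0∞)⁻¹ * μHE[d] X := by
      intro X
      rw [Measure.euclideanHausdorffMeasure_def, Measure.smul_apply, ENNReal.smul_def,
        smul_eq_mul, ← mul_assoc, ← ha, ENNReal.inv_mul_cancel (by simpa using ha0) (by simp),
        one_mul]
    refine ⟨(a : ℝ≥0∞)⁻¹, by simp, by simpa using ha0, ?_, fun S _ hS => ?_⟩
    · simp only [tube, if_true, hsc]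
      simp only [zero_div, add_zero, one_mul] at hMr ⊢
      gcongr
    · simp only [tube, if_true, hsc, add_zero]
      gcongr
      exact h.euclideanHausdorffMeasure_le_inter hy (hd y hy) hs hsτ hS
  · have hk : ∀ z ∈ M, Module.finrank ℝ (T z)ᗮ = D - d := by
      intro z hz
      have := (T z).finrank_add_finrank_orthogonal
      rw [hd z hz, finrank_euclideanSpace_fin] at this
      omega
    refine ⟨volume (ball (0 : EuclideanSpace ℝ (Fin (D - d))) σ),
      (measure_ball_pos _ _ hσ0).ne', measure_ball_lt_top.ne, ?_, fun S hS hSs => ?_⟩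
    · simp only [tube, if_neg hσ0.ne']
      have hfin : μHE[d] (M ∩ closedBall y (r + σ)) ≠ ∞ :=
        ne_top_of_le_ne_top (ENNReal.mul_ne_top (by simp) measure_closedBall_lt_top.ne) hMr
      refine (h.volume_tube_le hU hd hk hσ0 (by linarith) inter_subset_left
        (h.isCompact.measurableSet.inter measurableSet_closedBall) hfin
        (isOpen_thickening.measurableSet.inter measurableSet_closedBall) ?_).trans ?_
      · rintro x ⟨hx, hxr⟩
        obtain ⟨z, hz, hzd⟩ := h.isCompact.exists_infDist_eq_dist ⟨y, hy⟩ x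
        have hlt : dist x z < σ := by
          rw [← hzd]; exact (mem_thickening_iff_infDist_lt ⟨y, hy⟩).1 hx
        refine ⟨z, ⟨hz, ?_⟩, hzd.symm, hlt⟩
        rw [mem_closedBall] at hxr ⊢
        have := dist_triangle z x y
        rw [dist_comm z x] at this
        linarith
      · rw [ENNReal.ofReal_mul (by positivity), mul_pow]
        exact (mul_le_mul' le_rfl hMr).trans_eq (by ring)
    · simp only [tube, if_neg hσ0.ne']
      exact h.volume_mul_le_volume_thickening hy (hk y hy) hs hsτ hS hSs

/-! ### Second moments of Euclidean balls -/

section BallMoment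

variable {E : Type*} [NormedAddCommGroup E] [InnerProductSpace ℝ E] [FiniteDimensional ℝ E]
  [MeasurableSpace E] [BorelSpace E]

theorem Continuous.integrableOn_ball {f : E → ℝ} (hf : Continuous f) (x : E) (r : ℝ) :
    IntegrableOn f (ball x r) :=
  (hf.continuousOn.integrableOn_compact (isCompact_closedBall x r)).mono_set ball_subset_closedBall

theorem LinearIsometryEquiv.setIntegral_ball_comp (f : E ≃ₗᵢ[ℝ] E) (g : E → ℝ) (r : ℝ) :
    ∫ w in ball 0 r, g (f w) = ∫ w in ball 0 r, g w := by
  have h := f.measurePreserving.setIntegral_preimage_emb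
    f.toHomeomorph.measurableEmbedding g (ball 0 r)
  rw [← h]
  congr 2
  ext w
  simp

theorem setIntegral_ball_norm_sq [Nontrivial E] {r : ℝ} (hr : 0 < r) :
    ∫ w in ball (0 : E) r, ‖w‖ ^ 2 =
      Module.finrank ℝ E * r ^ 2 / (Module.finrank ℝ E + 2) * volume.real (ball (0 : E) r) := by
  have hd : 0 < Module.finrank ℝ E := Module.finrank_pos
  obtain ⟨n, hn⟩ := Nat.exists_eq_add_one_of_ne_zero hd.ne'
  rw [← integral_indicator measurableSet_ball]
  have e1 : (ball (0 : E) r).indicator (fun w => ‖w‖ ^ 2) =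
      fun w => (Iio r).indicator (fun t : ℝ => t ^ 2) ‖w‖ := by
    ext w
    simp [indicator]
  rw [e1, integral_fun_norm_addHaar volume ((Iio r).indicator fun t : ℝ => t ^ 2)]
  have e2 : ∫ t in Ioi (0 : ℝ), t ^ (Module.finrank ℝ E - 1) •
      (Iio r).indicator (fun t : ℝ => t ^ 2) t = r ^ (n + 3) / (n + 3) := by
    have : (fun t : ℝ => t ^ (Module.finrank ℝ E - 1) • (Iio r).indicator (fun t : ℝ => t ^ 2) t) =
        (Iio r).indicator fun t => t ^ (n + 2) := by
      ext t
      rw [hn, Nat.add_sub_cancel]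
      by_cases ht : t ∈ Iio r
      · rw [indicator_of_mem ht, indicator_of_mem ht, smul_eq_mul]; ring
      · rw [indicator_of_notMem ht, indicator_of_notMem ht, smul_zero]
    rw [this, setIntegral_indicator measurableSet_Iio, Ioi_inter_Iio,
      ← integral_Ioc_eq_integral_Ioo, ← intervalIntegral.integral_of_le hr.le, integral_pow]
    push_cast
    simp
    ring_nf
  rw [e2, Measure.real, Measure.real, Measure.addHaar_ball_of_pos _ _ hr, ENNReal.toReal_mul,
    ENNReal.toReal_ofReal (by positivity), hn]
  simp only [nsmul_eq_mul, smul_eq_mul]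
  push_cast
  field_simp
  ring

/-- A reflection exchanges `u` with `‖u‖ • b i`, so all directions have equal second moments, and
over an orthonormal basis these sum to the integral of `‖w‖²`. -/
theorem setIntegral_ball_inner_sq (u : E) {r : ℝ} (hr : 0 < r) :
    ∫ w in ball (0 : E) r, ⟪u, w⟫_ℝ ^ 2 =
      ‖u‖ ^ 2 * (r ^ 2 / (Module.finrank ℝ E + 2)) * volume.real (ball (0 : E) r) := by
  rcases eq_or_ne u 0 with rfl | hu
  · simp
  have : Nontrivial E := ⟨u, 0, hu⟩
  have hd : 0 < Module.finrank ℝ E := Module.finrank_pos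
  set b := stdOrthonormalBasis ℝ E with hb
  have key : ∀ i, ∫ w in ball (0 : E) r, ⟪u, w⟫_ℝ ^ 2 =
      ‖u‖ ^ 2 * ∫ w in ball (0 : E) r, ⟪b i, w⟫_ℝ ^ 2 := by
    intro i
    set v := ‖u‖ • b i with hv
    have hvn : ‖u‖ = ‖v‖ := by rw [hv, norm_smul, norm_norm, b.norm_eq_one, mul_one]
    have h1 := Submodule.reflection_sub hvn
    set f := (ℝ ∙ (u - v))ᗮ.reflection with hf
    rw [← LinearIsometryEquiv.setIntegral_ball_comp f, ← integral_const_mul]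
    congr with w
    have h2 : f (f w) = w := Submodule.reflection_reflection _ w
    have h3 : ⟪u, f w⟫_ℝ = ⟪v, w⟫_ℝ := by
      rw [← f.inner_map_map u (f w), h1, h2]
    rw [h3, hv, real_inner_smul_left]
    ring
  have hsum : ∑ i, ∫ w in ball (0 : E) r, ⟪b i, w⟫_ℝ ^ 2 = ∫ w in ball (0 : E) r, ‖w‖ ^ 2 := by
    rw [← integral_finsetSum _ fun i _ =>
      Continuous.integrableOn_ball (by fun_prop) _ _]
    congr with w
    rw [← b.sum_sq_norm_inner_right w]
    simp
  have h4 : (Module.finrank ℝ E : ℝ) * ∫ w in ball (0 : E) r, ⟪u, w⟫_ℝ ^ 2 =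
      ‖u‖ ^ 2 * ∫ w in ball (0 : E) r, ‖w‖ ^ 2 := by
    rw [← hsum, Finset.mul_sum, Finset.sum_congr rfl fun i _ => (key i).symm]
    simp
  rw [setIntegral_ball_norm_sq hr] at h4
  have hd' : (0 : ℝ) < Module.finrank ℝ E := by exact_mod_cast hd
  refine mul_left_cancel₀ hd'.ne' (h4.trans ?_)
  ring

/-- Second moments of a ball about arbitrary centers are at least those about its center. -/
theorem le_setIntegral_ball_inner_sub_sq (u : E) (c : ℝ) {r : ℝ} (hr : 0 < r) :
    ‖u‖ ^ 2 * (r ^ 2 / (Module.finrank ℝ E + 2)) * volume.real (ball (0 : E) r) ≤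
      ∫ w in ball (0 : E) r, (⟪u, w⟫_ℝ - c) ^ 2 := by
  have h1 := LinearIsometryEquiv.setIntegral_ball_comp (LinearIsometryEquiv.neg ℝ (E := E))
    (fun w => (⟪u, w⟫_ℝ - c) ^ 2) r
  have h2 : 2 * ∫ w in ball (0 : E) r, (⟪u, w⟫_ℝ - c) ^ 2 =
      ∫ w in ball (0 : E) r, ((⟪u, w⟫_ℝ - c) ^ 2 + (⟪u, -w⟫_ℝ - c) ^ 2) := by
    rw [integral_add (Continuous.integrableOn_ball (by fun_prop) _ _)
      (Continuous.integrableOn_ball (by fun_prop) _ _)]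
    simp only [LinearIsometryEquiv.coe_neg] at h1
    rw [h1]
    ring
  have h3 : 2 * ∫ w in ball (0 : E) r, ⟪u, w⟫_ℝ ^ 2 ≤
      ∫ w in ball (0 : E) r, ((⟪u, w⟫_ℝ - c) ^ 2 + (⟪u, -w⟫_ℝ - c) ^ 2) := by
    rw [← integral_const_mul]
    refine setIntegral_mono (Continuous.integrableOn_ball (by fun_prop) _ _)
      (Continuous.integrableOn_ball (by fun_prop) _ _) fun w => ?_
    simp only [inner_neg_right]
    nlinarith [sq_nonneg c]
  rw [← setIntegral_ball_inner_sq u hr]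
  linarith

end BallMoment

/-! ### Courant–Fischer bound for the covariance matrix -/

section Eigenvalues

-- By dimension count `K` contains a nonzero vector orthogonal to the eigenvectors of index less
-- than `i`, and there the quadratic form is at most the eigenvalue of index `i` (counted from zero)
-- times the squared norm.
open Matrix in
theorem Matrix.IsHermitian.le_eigenvalues₀ {D : ℕ} {A : Matrix (Fin D) (Fin D) ℝ}
    (hA : A.IsHermitian) (K : Submodule ℝ (EuclideanSpace ℝ (Fin D))) {c : ℝ}
    (hK : ∀ u ∈ K, c * ‖u‖ ^ 2 ≤ ∑ i, ∑ j, u i * u j * A i j)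
    (i : Fin (Fintype.card (Fin D))) (hi : (i : ℕ) < Module.finrank ℝ K) :
    c ≤ hA.eigenvalues₀ i := by
  set e := Fintype.equivOfCardEq (Fintype.card_fin (Fintype.card (Fin D))) with he
  set b := hA.eigenvectorBasis with hb
  have heig : ∀ j, hA.eigenvalues (e j) = hA.eigenvalues₀ j := fun j => by
    simp [Matrix.IsHermitian.eigenvalues, he]
  let L : K →ₗ[ℝ] (Fin (i : ℕ) → ℝ) := LinearMap.pi fun j =>
    ((innerSL ℝ (b (e ⟨j, j.2.trans i.2⟩))).toLinearMap).comp K.subtype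
  have hker : LinearMap.ker L ≠ ⊥ := LinearMap.ker_ne_bot_of_finrank_lt (by simpa using hi)
  obtain ⟨w, hw, hw0⟩ := Submodule.exists_mem_ne_zero_of_ne_bot hker
  have hwj : ∀ j : Fin (Fintype.card (Fin D)), j < i → ⟪b (e j), (w : EuclideanSpace ℝ (Fin D))⟫_ℝ = 0 := by
    intro j hj
    have := congrFun (LinearMap.mem_ker.1 hw) ⟨j, hj⟩
    simpa [L] using this
  have hquad : ∑ k, ∑ j, (w : EuclideanSpace ℝ (Fin D)) k * (w : EuclideanSpace ℝ (Fin D)) j * A k j =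
      ∑ j, hA.eigenvalues j * ⟪b j, (w : EuclideanSpace ℝ (Fin D))⟫_ℝ ^ 2 := by
    have hsym : A.toEuclideanLin.IsSymmetric := Matrix.isSymmetric_toEuclideanLin_iff.2 hA
    have hbj : ∀ j, A.toEuclideanLin (b j) = hA.eigenvalues j • b j := fun j => by
      have := hA.mulVec_eigenvectorBasis j
      ext k
      simpa [Matrix.toLpLin_apply] using congrFun this k
    have h1 : ⟪(w : EuclideanSpace ℝ (Fin D)), A.toEuclideanLin w⟫_ℝ =
        ∑ j, hA.eigenvalues j * ⟪b j, (w : EuclideanSpace ℝ (Fin D))⟫_ℝ ^ 2 := by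
      rw [← b.sum_inner_mul_inner]
      refine Finset.sum_congr rfl fun j _ => ?_
      rw [← hsym, hbj, real_inner_smul_left, real_inner_comm (b j)]
      ring
    rw [← h1, PiLp.inner_apply]
    refine Finset.sum_congr rfl fun k _ => ?_
    simp only [Matrix.toLpLin_apply, Matrix.mulVec, dotProduct, RCLike.inner_apply, conj_trivial,
      Finset.sum_mul]
    exact Finset.sum_congr rfl fun j _ => by ring
  have hpos : 0 < ‖(w : EuclideanSpace ℝ (Fin D))‖ ^ 2 := by
    have : (w : EuclideanSpace ℝ (Fin D)) ≠ 0 := by simpa using hw0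
    positivity
  have hle := hK w w.2
  rw [hquad] at hle
  have hle2 : ∑ j, hA.eigenvalues j * ⟪b j, (w : EuclideanSpace ℝ (Fin D))⟫_ℝ ^ 2 ≤
      hA.eigenvalues₀ i * ‖(w : EuclideanSpace ℝ (Fin D))‖ ^ 2 := by
    rw [← b.sum_sq_norm_inner_right (w : EuclideanSpace ℝ (Fin D)), Finset.mul_sum]
    refine Finset.sum_le_sum fun j _ => ?_
    obtain ⟨k, rfl⟩ := e.surjective j
    rw [heig, Real.norm_eq_abs, sq_abs]
    rcases lt_or_ge k i with hk | hk
    · rw [hwj k hk]; simp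
    · exact mul_le_mul_of_nonneg_right (hA.eigenvalues₀_antitone hk) (sq_nonneg _)
  exact le_of_mul_le_mul_right (hle.trans hle2) hpos

theorem le_covEigenvalue {Ω : Type*} [MeasurableSpace Ω] {D d : ℕ} {P : Measure Ω}
    [IsProbabilityMeasure P] {Z : Ω → EuclideanSpace ℝ (Fin D)} (hZ : MemLp Z 2 P)
    (hd : 1 ≤ d) (hdD : d ≤ D) (K : Submodule ℝ (EuclideanSpace ℝ (Fin D)))
    (hKd : Module.finrank ℝ K = d) {c : ℝ}
    (hK : ∀ u ∈ K, c * ‖u‖ ^ 2 ≤ ∫ ω, ⟪u, Z ω - ∫ ω', Z ω' ∂P⟫_ℝ ^ 2 ∂P) :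
    c ≤ covEigenvalue P Z d hd hdD := by
  have hint : Integrable Z P := hZ.integrable (by norm_num)
  refine Matrix.IsHermitian.le_eigenvalues₀ _ K (fun u hu => (hK u hu).trans_eq ?_) _
    (by simp only [hKd]; omega)
  set m := ∫ ω', Z ω' ∂P with hm
  have hmi : ∀ i, ∫ ω, Z ω i ∂P = m i := fun i =>
    (EuclideanSpace.proj (𝕜 := ℝ) i).integral_comp_comm hint
  have hX : MemLp (fun ω => Z ω - m) 2 P := hZ.sub (memLp_const m)
  have hXi : ∀ i, MemLp (fun ω => Z ω i - m i) 2 P := fun i =>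
    (EuclideanSpace.proj (𝕜 := ℝ) i).comp_memLp' hX
  have hprod : ∀ i j, Integrable (fun ω => (Z ω i - m i) * (Z ω j - m j)) P := fun i j =>
    (hXi i).integrable_mul (hXi j)
  have hexp : ∀ ω, ⟪u, Z ω - m⟫_ℝ ^ 2 =
      ∑ i, ∑ j, u i * u j * ((Z ω i - m i) * (Z ω j - m j)) := by
    intro ω
    rw [PiLp.inner_apply, sq, Finset.sum_mul_sum]
    refine Finset.sum_congr rfl fun i _ => Finset.sum_congr rfl fun j _ => ?_
    simp only [RCLike.inner_apply, conj_trivial, PiLp.sub_apply]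
    ring
  simp_rw [hexp]
  rw [integral_finsetSum _ fun i _ => integrable_finsetSum _ fun j _ => (hprod i j).const_mul _]
  refine Finset.sum_congr rfl fun i _ => ?_
  rw [integral_finsetSum _ fun j _ => (hprod i j).const_mul _]
  refine Finset.sum_congr rfl fun j _ => ?_
  rw [integral_const_mul, covMatrix, Matrix.of_apply, covariance, hmi, hmi]

end Eigenvalues

/-! ### Closeness of two subspaces with small residuals -/

section PrincipalSubspace

variable {E : Type*} [NormedAddCommGroup E] [InnerProductSpace ℝ E] [FiniteDimensional ℝ E]

/-- If both `V` and `K` approximate `X` well in mean square, and `X` has substantial variance in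
all the directions of `K`, then `K` is close to `V`. -/
theorem mul_norm_sub_starProjection_sq_le {Ω : Type*} [MeasurableSpace Ω] {P : Measure Ω}
    {X : Ω → E} (hX : MemLp X 2 P) (V K : Submodule ℝ E) {l e : ℝ} (hl : 0 ≤ l)
    (hV : ∫ ω, ‖X ω - V.starProjection (X ω)‖ ^ 2 ∂P ≤ e)
    (hKe : ∫ ω, ‖X ω - K.starProjection (X ω)‖ ^ 2 ∂P ≤ e)
    (hK : ∀ u ∈ K, l * ‖u‖ ^ 2 ≤ ∫ ω, ⟪u, X ω⟫_ℝ ^ 2 ∂P) {w : E} (hw : w ∈ K) :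
    l * ‖w - V.starProjection w‖ ^ 2 ≤ 4 * e * ‖w‖ ^ 2 := by
  have he : 0 ≤ e := (integral_nonneg fun ω => sq_nonneg _).trans hV
  set q := w - V.starProjection w with hq
  set p := K.starProjection q with hp
  have hres : ∀ L : Submodule ℝ E,
      Integrable (fun ω => ‖X ω - L.starProjection (X ω)‖ ^ 2) P := fun L =>
    (hX.sub (L.starProjection.comp_memLp' hX)).integrable_norm_pow (by norm_num)
  have hqV : q ∈ Vᗮ := V.sub_starProjection_mem_orthogonal w
  have hqp : q - p ∈ Kᗮ := K.sub_starProjection_mem_orthogonal q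
  have hqpn : ‖q - p‖ ≤ ‖q‖ := by
    rw [hp, ← Submodule.starProjection_orthogonal_val]
    exact Submodule.norm_starProjection_apply_le _ _
  -- A large `q` forces a large `p` in `K`, where the variance of `X` is bounded below.
  have hqq : ‖q‖ ^ 2 ≤ ‖p‖ * ‖w‖ := by
    have h1 : ‖q‖ ^ 2 = ⟪q, w⟫_ℝ := by
      have h2 : ⟪q, V.starProjection w⟫_ℝ = 0 :=
        Submodule.inner_left_of_mem_orthogonal (V.starProjection_apply_mem w) hqV
      rw [← real_inner_self_eq_norm_sq]
      conv_lhs => rw [hq]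
      rw [← hq, inner_sub_left, real_inner_comm, real_inner_comm q (V.starProjection w), h2,
        sub_zero]
    have h3 : ⟪q, w⟫_ℝ = ⟪p, w⟫_ℝ := by
      have := Submodule.inner_left_of_mem_orthogonal hw hqp
      rw [inner_sub_left] at this
      linarith
    rw [h1, h3]
    exact real_inner_le_norm _ _
  -- Write `p = q - (q - p)` with `q` orthogonal to `V` and `q - p` orthogonal to `K`: each term
  -- sees only the residual of `X` with respect to that subspace.
  have hpt : ∀ ω, ⟪p, X ω⟫_ℝ ^ 2 ≤ 2 * ‖q‖ ^ 2 *
      (‖X ω - V.starProjection (X ω)‖ ^ 2 + ‖X ω - K.starProjection (X ω)‖ ^ 2) := by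
    intro ω
    have h1 : ⟪q, X ω⟫_ℝ = ⟪q, X ω - V.starProjection (X ω)⟫_ℝ := by
      rw [inner_sub_right, Submodule.inner_left_of_mem_orthogonal
        (V.starProjection_apply_mem _) hqV, sub_zero]
    have h2 : ⟪q - p, X ω⟫_ℝ = ⟪q - p, X ω - K.starProjection (X ω)⟫_ℝ := by
      rw [inner_sub_right, Submodule.inner_left_of_mem_orthogonal
        (K.starProjection_apply_mem _) hqp, sub_zero]
    have h3 : ⟪p, X ω⟫_ℝ = ⟪q, X ω⟫_ℝ - ⟪q - p, X ω⟫_ℝ := by rw [inner_sub_left q p]; ring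
    have h4 : ⟪q, X ω⟫_ℝ ^ 2 ≤ (‖q‖ * ‖X ω - V.starProjection (X ω)‖) ^ 2 := by
      rw [h1]
      exact sq_le_sq' (neg_le_of_abs_le (abs_real_inner_le_norm _ _)) (real_inner_le_norm _ _)
    have h5 : ⟪q - p, X ω⟫_ℝ ^ 2 ≤ (‖q‖ * ‖X ω - K.starProjection (X ω)‖) ^ 2 := by
      have h6 : |⟪q - p, X ω⟫_ℝ| ≤ ‖q‖ * ‖X ω - K.starProjection (X ω)‖ := by
        rw [h2]
        exact (abs_real_inner_le_norm _ _).trans (by gcongr)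
      exact sq_le_sq' (neg_le_of_abs_le h6) (le_of_abs_le h6)
    rw [h3]
    nlinarith [sq_nonneg (⟪q, X ω⟫_ℝ + ⟪q - p, X ω⟫_ℝ)]
  have hlp : l * ‖p‖ ^ 2 ≤ 4 * e * ‖q‖ ^ 2 := by
    refine (hK p (K.starProjection_apply_mem q)).trans ?_
    have hin : Integrable (fun ω => ⟪p, X ω⟫_ℝ ^ 2) P :=
      ((innerSL ℝ p).comp_memLp' hX).integrable_sq
    refine (integral_mono hin (((hres V).add (hres K)).const_mul _) hpt).trans ?_
    simp only [Pi.add_apply]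
    rw [integral_const_mul, integral_add (hres V) (hres K)]
    nlinarith [sq_nonneg ‖q‖]
  rcases eq_or_ne q 0 with h0 | h0
  · rw [h0]
    simp only [norm_zero, ne_eq, OfNat.ofNat_ne_zero, not_false_eq_true, zero_pow, mul_zero]
    positivity
  · have hq0 : 0 < ‖q‖ ^ 2 := by positivity
    have h1 : l * ‖q‖ ^ 2 * ‖q‖ ^ 2 ≤ 4 * e * ‖w‖ ^ 2 * ‖q‖ ^ 2 := by
      calc l * ‖q‖ ^ 2 * ‖q‖ ^ 2 = l * (‖q‖ ^ 2) ^ 2 := by ring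
        _ ≤ l * (‖p‖ * ‖w‖) ^ 2 := by gcongr
        _ = l * ‖p‖ ^ 2 * ‖w‖ ^ 2 := by ring
        _ ≤ 4 * e * ‖q‖ ^ 2 * ‖w‖ ^ 2 := by gcongr
        _ = _ := by ring
    exact le_of_mul_le_mul_right h1 hq0

end PrincipalSubspace

/-! ### Moments of random vectors -/

section Moments

variable {Ω : Type*} [MeasurableSpace Ω] {P : Measure Ω}
  {E : Type*} [NormedAddCommGroup E] [InnerProductSpace ℝ E] [FiniteDimensional ℝ E]

theorem integral_norm_sub_integral_sq_le [IsProbabilityMeasure P] {X : Ω → E}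
    (hX : MemLp X 2 P) : ∫ ω, ‖X ω - ∫ ω', X ω' ∂P‖ ^ 2 ∂P ≤ ∫ ω, ‖X ω‖ ^ 2 ∂P := by
  have hint : Integrable X P := hX.integrable (by norm_num)
  have hsq : Integrable (fun ω => ‖X ω‖ ^ 2) P := hX.integrable_norm_pow (by norm_num)
  set m := ∫ ω', X ω' ∂P with hm
  have h1 : ∀ ω, ‖X ω - m‖ ^ 2 = ‖X ω‖ ^ 2 - 2 * ⟪m, X ω⟫_ℝ + ‖m‖ ^ 2 := fun ω => by
    rw [norm_sub_sq_real, real_inner_comm]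
  have hin : Integrable (fun ω => ⟪m, X ω⟫_ℝ) P := hint.const_inner m
  simp_rw [h1]
  have hsub : Integrable (fun ω => ‖X ω‖ ^ 2 - 2 * ⟪m, X ω⟫_ℝ) P := hsq.sub (hin.const_mul 2)
  rw [integral_add hsub (integrable_const _), integral_sub hsq (hin.const_mul 2), integral_const_mul, integral_inner hint, ← hm,
    real_inner_self_eq_norm_sq]
  simp only [integral_const, probReal_univ, one_smul]
  linarith [sq_nonneg ‖m‖]

/-- A random vector whose law dominates a multiple of Lebesgue measure on a ball has second moments
at least those of that part of its law. -/
theorem le_integral_inner_sub_sq_of_le_map [MeasurableSpace E] [BorelSpace E]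
    [IsFiniteMeasure P] {Y : Ω → E} (hY : MemLp Y 2 P) {θ : ℝ≥0∞} {ρ : ℝ} (hρ : 0 < ρ)
    (hθ : ∀ S ⊆ ball (0 : E) ρ, MeasurableSet S → θ * volume S ≤ P.map Y S) (u : E) (c : ℝ) :
    ‖u‖ ^ 2 * (ρ ^ 2 / (Module.finrank ℝ E + 2)) * (θ * volume (ball (0 : E) ρ)).toReal ≤
      ∫ ω, (⟪u, Y ω⟫_ℝ - c) ^ 2 ∂P := by
  have hle : θ • volume.restrict (ball (0 : E) ρ) ≤ P.map Y := by
    refine Measure.le_iff.2 fun S hS => ?_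
    rw [Measure.smul_apply, Measure.restrict_apply hS, smul_eq_mul]
    exact (hθ _ inter_subset_right (hS.inter measurableSet_ball)).trans
      (measure_mono inter_subset_left)
  have hYm : AEMeasurable Y P := hY.1.aemeasurable
  have hcont : Continuous fun w : E => (⟪u, w⟫_ℝ - c) ^ 2 := by fun_prop
  have hint : Integrable (fun ω => (⟪u, Y ω⟫_ℝ - c) ^ 2) P :=
    (((innerSL ℝ u).comp_memLp' hY).sub (memLp_const c)).integrable_sq
  rw [← integral_map (f := fun w : E => (⟪u, w⟫_ℝ - c) ^ 2) hYm hcont.aestronglyMeasurable]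
  refine le_trans ?_ (integral_mono_measure hle (ae_of_all _ fun w => sq_nonneg _)
    ((integrable_map_measure hcont.aestronglyMeasurable hYm).2 hint))
  rw [integral_smul_measure, ENNReal.toReal_mul, smul_eq_mul, mul_left_comm]
  exact mul_le_mul_of_nonneg_left (le_setIntegral_ball_inner_sub_sq u c hρ) ENNReal.toReal_nonneg

end Moments

/-! ### The conditional law projected to the tangent space -/

section Law

variable {D d : ℕ} {M : Set (EuclideanSpace ℝ (Fin D))} {τ σ s r : ℝ}
  {T : EuclideanSpace ℝ (Fin D) → Submodule ℝ (EuclideanSpace ℝ (Fin D))}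
  {y : EuclideanSpace ℝ (Fin D)} {Q : Set (EuclideanSpace ℝ (Fin D))}

/-- Merging the two conditionings needs a tube of finite measure. This comes from the conditional
law being nonzero, as conditioning on a set of infinite measure gives the zero measure. -/
theorem cond_uniformTube (hM : IsCompact M) (hQ : MeasurableSet Q)
    (h : cond (uniformTube d M σ) Q ≠ 0) :
    cond (uniformTube d M σ) Q =
      cond (if σ = 0 then Measure.hausdorffMeasure (d : ℝ) else volume) (tube M σ ∩ Q) := by
  refine cond_cond_eq_cond_inter' (measurableSet_tube hM σ) hQ fun htop => h ?_
  have h0 : uniformTube d M σ = 0 := cond_eq_zero.2 (Or.inl htop)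
  rw [h0]
  exact cond_eq_zero.2 (Or.inr rfl)

theorem HasReachGeometry.mul_volume_le_cond_uniformTube (h : HasReachGeometry M τ T)
    (hU : ∀ x, infDist x M < τ → ∃! m, m ∈ M ∧ dist x m = infDist x M)
    (hd : ∀ z ∈ M, Module.finrank ℝ (T z) = d) (hσ : 0 ≤ σ) (hs : 0 < s) (hsτ : s ≤ τ / 2)
    (hr0 : 0 ≤ r) (hrτ : 2 * (r + σ) < τ) (hy : y ∈ M) (hQ : MeasurableSet Q)
    (hQ₁ : ball y (s + σ) ⊆ Q) (hQ₂ : tube M σ ∩ Q ⊆ closedBall y r)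
    (hne : cond (uniformTube d M σ) Q ≠ 0) {S : Set (T y)} (hS : MeasurableSet S)
    (hSs : S ⊆ ball 0 (s * √(1 - (s / (2 * τ)) ^ 2))) :
    (ENNReal.ofReal ((1 + σ / τ) * (√(1 - (2 * (r + σ) / τ) ^ 2))⁻¹) ^ d *
        volume (closedBall (0 : T y) (r + σ)))⁻¹ * volume S ≤
      cond (uniformTube d M σ) Q ((fun x => (T y).orthogonalProjectionOnto (x - y)) ⁻¹' S) := by
  obtain ⟨κ, hκ0, hκ, hup, hlow⟩ := h.exists_tube_measure_bounds hU hd hσ hs hsτ hr0 hrτ hy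
  rw [cond_uniformTube h.isCompact hQ hne, cond_apply ((measurableSet_tube h.isCompact σ).inter hQ)]
  set μ : Measure (EuclideanSpace ℝ (Fin D)) :=
    if σ = 0 then Measure.hausdorffMeasure (d : ℝ) else volume
  set G := ENNReal.ofReal ((1 + σ / τ) * (√(1 - (2 * (r + σ) / τ) ^ 2))⁻¹) ^ d *
        volume (closedBall (0 : T y) (r + σ))
  calc G⁻¹ * volume S = (κ * G)⁻¹ * (κ * volume S) := by
        rw [ENNReal.mul_inv (Or.inl hκ0) (Or.inl hκ), mul_mul_mul_comm,
          ENNReal.inv_mul_cancel hκ0 hκ, one_mul]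
    _ ≤ _ := by
        refine mul_le_mul' (ENNReal.inv_le_inv.2 ?_) ((hlow S hS hSs).trans (measure_mono ?_))
        · exact (measure_mono (subset_inter inter_subset_left hQ₂)).trans hup
        · exact inter_subset_inter_left _ (inter_subset_inter_right _ hQ₁)

/-- The bound for the `d`-th eigenvalue of the covariance matrix. -/
theorem HasReachGeometry.eigenvalue_bound_le_integral (h : HasReachGeometry M τ T)
    (hU : ∀ x, infDist x M < τ → ∃! m, m ∈ M ∧ dist x m = infDist x M)
    (hd : ∀ z ∈ M, Module.finrank ℝ (T z) = d) (hσ : 0 ≤ σ) (hs : 0 < s) (hsτ : s ≤ τ / 2)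
    (hr0 : 0 < r) (hrτ : 2 * (r + σ) < τ) (hy : y ∈ M) (hQ : MeasurableSet Q)
    (hQ₁ : ball y (s + σ) ⊆ Q) (hQ₂ : tube M σ ∩ Q ⊆ closedBall y r)
    {Ω : Type*} [MeasurableSpace Ω] {P : Measure Ω} [IsProbabilityMeasure P]
    {Z : Ω → EuclideanSpace ℝ (Fin D)} (hZ : HasLaw Z (cond (uniformTube d M σ) Q) P)
    (hZ2 : MemLp Z 2 P) {u : EuclideanSpace ℝ (Fin D)} (hu : u ∈ T y)
    (m : EuclideanSpace ℝ (Fin D)) :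
    ‖u‖ ^ 2 * ((s * √(1 - (s / (2 * τ)) ^ 2)) ^ 2 / (d + 2)) *
      ((s * √(1 - (s / (2 * τ)) ^ 2)) ^ d /
        ((1 + σ / τ) * (√(1 - (2 * (r + σ) / τ) ^ 2))⁻¹ * (r + σ)) ^ d) ≤
      ∫ ω, ⟪u, Z ω - m⟫_ℝ ^ 2 ∂P := by
  have hτ := h.pos
  have hfin := hd y hy
  set ρ := s * √(1 - (s / (2 * τ)) ^ 2) with hρ
  set g := (1 + σ / τ) * (√(1 - (2 * (r + σ) / τ) ^ 2))⁻¹ with hg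
  have hρ0 : 0 < ρ := by
    refine mul_pos hs (Real.sqrt_pos.2 ?_)
    have h1 : s / (2 * τ) < 1 := by rw [div_lt_one (by positivity)]; linarith
    have h2 : 0 < s / (2 * τ) := by positivity
    nlinarith
  have hg0 : 0 < g := by
    refine mul_pos (by positivity) (inv_pos.2 (Real.sqrt_pos.2 ?_))
    have h1 : 2 * (r + σ) / τ < 1 := by rw [div_lt_one (by positivity)]; linarith
    have h2 : 0 < 2 * (r + σ) / τ := by positivity
    nlinarith
  have hne : cond (uniformTube d M σ) Q ≠ 0 := by
    rw [← hZ.map_eq]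
    have := Measure.isProbabilityMeasure_map (μ := P) hZ.aemeasurable
    exact IsProbabilityMeasure.ne_zero _
  let Y : Ω → T y := fun ω => (T y).orthogonalProjectionOnto (Z ω - y)
  have hpm : Measurable fun x => (T y).orthogonalProjectionOnto (x - y) := by fun_prop
  have hY : MemLp Y 2 P := (T y).orthogonalProjectionOnto.comp_memLp' (hZ2.sub (memLp_const y))
  have hmap : P.map Y = (P.map Z).map fun x => (T y).orthogonalProjectionOnto (x - y) :=
    (AEMeasurable.map_map_of_aemeasurable hpm.aemeasurable hZ.aemeasurable).symm
  -- For `u` in `T y` the inner product with `Z - m` depends on `Z` only through its projection `Y`,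
  -- up to the constant `⟪u, m - y⟫`.
  have key := le_integral_inner_sub_sq_of_le_map hY hρ0
    (θ := (ENNReal.ofReal g ^ d * volume (closedBall (0 : T y) (r + σ)))⁻¹)
    (fun S hSs hS => by
      rw [hmap, hZ.map_eq, Measure.map_apply hpm hS]
      exact h.mul_volume_le_cond_uniformTube hU hd hσ hs hsτ hr0.le hrτ hy hQ hQ₁ hQ₂ hne hS hSs)
    (⟨u, hu⟩ : T y) ⟪u, m - y⟫_ℝ
  have hYu : ∀ ω, ⟪(⟨u, hu⟩ : T y), Y ω⟫_ℝ - ⟪u, m - y⟫_ℝ = ⟪u, Z ω - m⟫_ℝ := fun ω => by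
    rw [Submodule.inner_orthogonalProjectionOnto_eq_of_mem_left, ← inner_sub_right,
      sub_sub_sub_cancel_right]
  simp_rw [hYu] at key
  refine le_of_eq_of_le ?_ key
  have hv0 : volume (ball (0 : T y) 1) ≠ 0 := (measure_ball_pos _ _ one_pos).ne'
  have hvt : volume (ball (0 : T y) 1) ≠ ∞ := measure_ball_lt_top.ne
  have hv : 0 < (volume (ball (0 : T y) 1)).toReal := ENNReal.toReal_pos hv0 hvt
  rw [Submodule.coe_norm, Measure.addHaar_closedBall _ _ (by positivity),
    Measure.addHaar_ball_of_pos _ _ hρ0, hfin]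
  simp only [ENNReal.toReal_mul, ENNReal.toReal_inv, ENNReal.toReal_pow,
    ENNReal.toReal_ofReal hg0.le, ENNReal.toReal_ofReal (pow_nonneg hρ0.le d),
    ENNReal.toReal_ofReal (pow_nonneg (by positivity : 0 ≤ r + σ) d), mul_pow g]
  field_simp

end Law

/-! ### Comparison of constants -/

section Constants

theorem Real.rpow_natCast_div_two {x : ℝ} (hx : 0 ≤ x) (n : ℕ) : x ^ ((n : ℝ) / 2) = √x ^ n := by
  rw [Real.rpow_div_two_eq_sqrt _ hx, Real.rpow_natCast]

/-- The lower bound for the `d`-th eigenvalue. -/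
noncomputable def eigenvalueBound (σ τ : ℝ) (d : ℕ) (r₁ r₂ : ℝ) : ℝ :=
  1 / (4 * (1 + σ / τ) ^ d) * ((r₁ - σ) / (r₂ + σ)) ^ d *
        ((1 - ((r₁ - σ) / (2 * τ)) ^ 2) /
          (1 + (2 * (r₂ + σ) / (τ - 2 * (r₂ + σ))) ^ 2)) ^ ((d : ℝ) / 2) *
        ((r₁ - σ) ^ 2 / d)

variable {σ τ r₁ r₂ : ℝ} {d : ℕ}

theorem one_sub_sq_pos (hσr : σ < r₁) (hr : r₁ < τ / 8) (hσ : 0 ≤ σ) :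
    3 / 4 < 1 - ((r₁ - σ) / (2 * τ)) ^ 2 := by
  have h1 : (r₁ - σ) / (2 * τ) < 1 / 2 := by rw [div_lt_iff₀ (by linarith)]; linarith
  have h2 : 0 < (r₁ - σ) / (2 * τ) := div_pos (by linarith) (by linarith)
  nlinarith

theorem eigenvalueBound_pos (hd : 1 ≤ d) (hσ : 0 ≤ σ) (hσr : σ < r₁) (hr : r₁ < r₂)
    (hrτ : r₂ < τ / 8 - σ) : 0 < eigenvalueBound σ τ d r₁ r₂ := by
  have ha := one_sub_sq_pos hσr (by linarith : r₁ < τ / 8) hσ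
  have h1 : 0 < r₁ - σ := by linarith
  have h2 : 0 < r₂ + σ := by linarith
  have h3 : 0 < τ := by linarith
  have h4 : 0 < 1 - ((r₁ - σ) / (2 * τ)) ^ 2 := by linarith
  have h5 : (0 : ℝ) < d := by exact_mod_cast hd
  unfold eigenvalueBound
  positivity

/-- This identity turns the term `√(8 r₂² (⋯) / l)` of the subspace estimate, with `l` the
eigenvalue bound, into the stated one with `γ`. -/
theorem eigenvalueBound_mul_gammaConst_sq (hd : 1 ≤ d) (hσ : 0 ≤ σ) (hσr : σ < r₁) (hr : r₁ < r₂)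
    (hrτ : r₂ < τ / 8 - σ) :
    eigenvalueBound σ τ d r₁ r₂ * gammaConst σ τ d r₁ r₂ ^ 2 = 8 * (r₁ - σ) ^ 2 := by
  have ha := one_sub_sq_pos hσr (by linarith : r₁ < τ / 8) hσ
  have h1 : 0 < r₁ - σ := by linarith
  have h2 : 0 < r₂ + σ := by linarith
  have h3 : 0 < τ := by linarith
  have h4 : 0 < 1 - ((r₁ - σ) / (2 * τ)) ^ 2 := by linarith
  have h5 : (0 : ℝ) < d := by exact_mod_cast hd
  have hb : 0 < 1 + (2 * (r₂ + σ) / (τ - 2 * (r₂ + σ))) ^ 2 := by positivity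
  unfold eigenvalueBound gammaConst
  set a := 1 - ((r₁ - σ) / (2 * τ)) ^ 2
  set b := 1 + (2 * (r₂ + σ) / (τ - 2 * (r₂ + σ))) ^ 2
  have hq : ∀ x : ℝ, 0 ≤ x → (x ^ ((d : ℝ) / 2)) ^ 2 = x ^ d := fun x hx => by
    rw [← Real.rpow_natCast, ← Real.rpow_mul hx, ← Real.rpow_natCast]
    congr 1
    push_cast
    ring
  have hq4 : ((b / a) ^ ((d : ℝ) / 4)) ^ 2 = (b / a) ^ ((d : ℝ) / 2) := by
    rw [← Real.rpow_natCast, ← Real.rpow_mul (by positivity)]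
    congr 1
    push_cast
    ring
  have hinv : (b / a) ^ ((d : ℝ) / 2) = ((a / b) ^ ((d : ℝ) / 2))⁻¹ := by
    rw [← Real.inv_rpow (by positivity), inv_div]
  have hpos : 0 < (a / b) ^ ((d : ℝ) / 2) := by positivity
  rw [mul_pow, mul_pow, mul_pow, mul_pow, hq _ (by positivity), hq _ (by positivity), hq4, hinv,
    Real.sq_sqrt (by positivity), div_pow, div_pow]
  field_simp
  norm_num

theorem eigenvalueBound_le (hd : 1 ≤ d) (hσ : 0 ≤ σ) (hσr : σ < r₁) (hr : r₁ < r₂)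
    (hrτ : r₂ < τ / 8 - σ) :
    eigenvalueBound σ τ d r₁ r₂ ≤
      ((r₁ - σ) * √(1 - ((r₁ - σ) / (2 * τ)) ^ 2)) ^ 2 / (d + 2) *
        (((r₁ - σ) * √(1 - ((r₁ - σ) / (2 * τ)) ^ 2)) ^ d /
          ((1 + σ / τ) * (√(1 - (2 * (r₂ + σ) / τ) ^ 2))⁻¹ * (r₂ + σ)) ^ d) := by
  have ha := one_sub_sq_pos hσr (by linarith : r₁ < τ / 8) hσ
  have h1 : 0 < r₁ - σ := by linarith
  have h2 : 0 < r₂ + σ := by linarith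
  have h3 : 0 < τ := by linarith
  have h4 : 0 < 1 - ((r₁ - σ) / (2 * τ)) ^ 2 := by linarith
  have h5 : (1 : ℝ) ≤ d := by exact_mod_cast hd
  have hb : 0 < 1 + (2 * (r₂ + σ) / (τ - 2 * (r₂ + σ))) ^ 2 := by positivity
  -- With `w = 2(r₂ + σ)` this reduces to `(τ - w)² + w² ≤ τ²`.
  have ht : 1 / (1 + (2 * (r₂ + σ) / (τ - 2 * (r₂ + σ))) ^ 2) ≤ 1 - (2 * (r₂ + σ) / τ) ^ 2 := by
    have h6 : 0 < τ - 2 * (r₂ + σ) := by linarith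
    set w := 2 * (r₂ + σ) with hw
    have hw0 : 0 < w := by positivity
    have hle : (w / τ) ^ 2 * (1 + (w / (τ - w)) ^ 2) ≤ (w / (τ - w)) ^ 2 := by
      have e : (w / τ) ^ 2 * (1 + (w / (τ - w)) ^ 2) =
          w ^ 2 * ((τ - w) ^ 2 + w ^ 2) / (τ ^ 2 * (τ - w) ^ 2) := by field_simp
      have e' : (w / (τ - w)) ^ 2 = w ^ 2 * τ ^ 2 / (τ ^ 2 * (τ - w) ^ 2) := by field_simp
      rw [e, e']
      gcongr
      nlinarith
    rw [div_le_iff₀ hb]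
    nlinarith
  unfold eigenvalueBound
  set a := 1 - ((r₁ - σ) / (2 * τ)) ^ 2
  set b := 1 + (2 * (r₂ + σ) / (τ - 2 * (r₂ + σ))) ^ 2
  set t := 1 - (2 * (r₂ + σ) / τ) ^ 2
  have ht0 : 0 < t := lt_of_lt_of_le (by positivity) ht
  have hroot : √(a / b) ≤ √a * √t := by
    rw [← Real.sqrt_mul h4.le]
    exact Real.sqrt_le_sqrt (by rw [div_eq_mul_one_div]; gcongr)
  -- From `a > 3/4` and `d + 2 ≤ 3d`.
  have hdd : 1 / (4 * (d : ℝ)) ≤ a / (d + 2) := by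
    rw [div_le_div_iff₀ (by positivity) (by positivity)]
    nlinarith
  have hs : 0 < √a := Real.sqrt_pos.2 h4
  have hst : 0 < √t := Real.sqrt_pos.2 ht0
  rw [Real.rpow_natCast_div_two (by positivity)]
  calc _ ≤ 1 / (4 * (1 + σ / τ) ^ d) * ((r₁ - σ) / (r₂ + σ)) ^ d * (√a * √t) ^ d *
        ((r₁ - σ) ^ 2 / d) := by gcongr
    _ = (r₁ - σ) ^ 2 * (1 / (4 * d)) * (((r₁ - σ) * √a) ^ d /
          ((1 + σ / τ) * (√t)⁻¹ * (r₂ + σ)) ^ d) := by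
        simp only [mul_pow, div_pow, inv_pow]
        field_simp
    _ ≤ (r₁ - σ) ^ 2 * (a / (d + 2)) * (((r₁ - σ) * √a) ^ d /
          ((1 + σ / τ) * (√t)⁻¹ * (r₂ + σ)) ^ d) := by gcongr
    _ = _ := by
        rw [mul_pow (r₁ - σ) √a 2, Real.sq_sqrt h4.le, mul_div_assoc]

end Constants

/-! ### Principal subspaces and conclusion -/

section PrincipalComponents

variable {D d : ℕ} {M : Set (EuclideanSpace ℝ (Fin D))} {τ σ r : ℝ}
  {T : EuclideanSpace ℝ (Fin D) → Submodule ℝ (EuclideanSpace ℝ (Fin D))}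
  {y : EuclideanSpace ℝ (Fin D)} {Q : Set (EuclideanSpace ℝ (Fin D))}

/-- A point `z` of `M` within `σ` of `x` satisfies `‖z - y‖ ≤ r + σ ≤ 2r`, so its normal part is at
most `(2r)² / (2τ)`. -/
theorem HasReachGeometry.norm_starProjection_orthogonal_le_of_mem_tube
    (h : HasReachGeometry M τ T) (hy : y ∈ M) (hσr : σ ≤ r) {x : EuclideanSpace ℝ (Fin D)}
    (hx : x ∈ tube M σ) (hxr : x ∈ closedBall y r) :
    ‖(T y)ᗮ.starProjection (x - y)‖ ≤ σ + 2 * r ^ 2 / τ := by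
  have hτ := h.pos
  obtain ⟨z, hz, hxz⟩ := exists_dist_le_of_mem_tube hx
  have hσ0 : 0 ≤ σ := dist_nonneg.trans hxz
  have h1 : ‖z - y‖ ≤ 2 * r := by
    rw [← dist_eq_norm]
    have := dist_triangle_left z y x
    rw [mem_closedBall] at hxr
    linarith
  have h2 : x - y = (x - z) + (z - y) := by abel
  rw [h2, map_add]
  refine (norm_add_le _ _).trans (add_le_add ?_ ?_)
  · refine ((T y)ᗮ.norm_starProjection_apply_le _).trans ?_
    rwa [← dist_eq_norm]
  · refine (h.norm_starProjection_orthogonal_le hy hz).trans ?_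
    calc ‖z - y‖ ^ 2 / (2 * τ) ≤ (2 * r) ^ 2 / (2 * τ) := by gcongr
      _ = 2 * r ^ 2 / τ := by field_simp

variable {Ω : Type*} [MeasurableSpace Ω] {P : Measure Ω} [IsProbabilityMeasure P]
  {Z : Ω → EuclideanSpace ℝ (Fin D)}

theorem ae_mem_of_hasLaw_cond_uniformTube (hM : IsCompact M) (hQ : MeasurableSet Q)
    (hZ : HasLaw Z (cond (uniformTube d M σ) Q) P) : ∀ᵐ ω ∂P, Z ω ∈ tube M σ ∩ Q := by
  have hne : cond (uniformTube d M σ) Q ≠ 0 := by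
    rw [← hZ.map_eq]
    have := Measure.isProbabilityMeasure_map (μ := P) hZ.aemeasurable
    exact IsProbabilityMeasure.ne_zero _
  have hm : MeasurableSet (tube M σ ∩ Q) := (measurableSet_tube hM σ).inter hQ
  refine (ae_map_iff hZ.aemeasurable hm).1 ?_
  rw [hZ.map_eq, cond_uniformTube hM hQ hne]
  exact ae_cond_mem hm

theorem HasReachGeometry.norm_sub_starProjection_le (h : HasReachGeometry M τ T)
    (hd : Module.finrank ℝ (T y) = d) (hy : y ∈ M) (hσr : σ ≤ r) (hσ : 0 ≤ σ)
    (hQ₂ : tube M σ ∩ Q ⊆ closedBall y r)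
    (hZm : AEMeasurable Z P) (hZ : ∀ᵐ ω ∂P, Z ω ∈ tube M σ ∩ Q) {l : ℝ} (hl : 0 < l)
    (hK : ∀ u ∈ T y, l * ‖u‖ ^ 2 ≤ ∫ ω, ⟪u, Z ω - ∫ ω', Z ω' ∂P⟫_ℝ ^ 2 ∂P)
    {V : Submodule ℝ (EuclideanSpace ℝ (Fin D))} (hV : IsPrincipalSubspace P Z d V)
    {x : EuclideanSpace ℝ (Fin D)} (hx : x ∈ tube M σ ∩ Q) :
    ‖x - (∫ ω, Z ω ∂P) - V.starProjection (x - ∫ ω, Z ω ∂P)‖ ≤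
      2 * σ + 4 * r ^ 2 / τ +
        √(8 * r ^ 2 * (4 * σ ^ 2 + 16 * r ^ 4 / τ ^ 2) / l) := by
  have hτ := h.pos
  have hr0 : 0 ≤ r := hσ.trans hσr
  have hbd : ∀ᵐ ω ∂P, ‖Z ω - y‖ ≤ r := by
    filter_upwards [hZ] with ω hω
    rw [← dist_eq_norm]
    exact hQ₂ hω
  have hZy : MemLp (fun ω => Z ω - y) 2 P :=
    MemLp.of_bound (hZm.aestronglyMeasurable.sub aestronglyMeasurable_const) r hbd
  have hZ2 : MemLp Z 2 P := by
    convert hZy.add (memLp_const y) using 1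
    ext ω : 1
    simp
  have hint : Integrable Z P := hZ2.integrable (by norm_num)
  set m := ∫ ω, Z ω ∂P with hm
  set N := (T y)ᗮ.starProjection with hN
  have hNbd : ∀ᵐ ω ∂P, ‖N (Z ω - y)‖ ≤ σ + 2 * r ^ 2 / τ := by
    filter_upwards [hZ] with ω hω
    exact h.norm_starProjection_orthogonal_le_of_mem_tube hy hσr hω.1 (hQ₂ hω)
  have hmy : ∫ ω, (Z ω - y) ∂P = m - y := by
    rw [integral_sub hint (integrable_const _)]; simp [hm]
  have hNm : ∫ ω, N (Z ω - y) ∂P = N (m - y) := by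
    rw [← hmy]
    exact N.integral_comp_comm (hint.sub (integrable_const y))
  have hmr : ‖m - y‖ ≤ r := by
    rw [← hmy]
    simpa using norm_integral_le_of_norm_le_const hbd
  have hNmr : ‖N (m - y)‖ ≤ σ + 2 * r ^ 2 / τ := by
    rw [← hNm]
    simpa using norm_integral_le_of_norm_le_const hNbd
  have hNL : MemLp (fun ω => N (Z ω - y)) 2 P := N.comp_memLp' hZy
  have hX : MemLp (fun ω => Z ω - m) 2 P := hZ2.sub (memLp_const m)
  -- An upper bound for `(σ + 2r²/τ)²`, the squared normal deviation from `y`; centring at the mean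
  -- only decreases the second moment.
  set e := 2 * σ ^ 2 + 8 * r ^ 4 / τ ^ 2 with he
  have hKe : ∫ ω, ‖(Z ω - m) - (T y).starProjection (Z ω - m)‖ ^ 2 ∂P ≤ e := by
    have h1 := integral_norm_sub_integral_sq_le hNL
    rw [hNm] at h1
    have h2 : ∀ ω, (Z ω - m) - (T y).starProjection (Z ω - m) = N (Z ω - y) - N (m - y) :=
      fun ω => by
        rw [← map_sub, sub_sub_sub_cancel_right, hN, Submodule.starProjection_orthogonal_val]
    simp_rw [h2]
    refine h1.trans ?_
    have h3 : ∫ ω, ‖N (Z ω - y)‖ ^ 2 ∂P ≤ ∫ _, e ∂P := by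
      refine integral_mono_ae (hNL.integrable_norm_pow (by norm_num)) (integrable_const _) ?_
      filter_upwards [hNbd] with ω hω
      calc ‖N (Z ω - y)‖ ^ 2 ≤ (σ + 2 * r ^ 2 / τ) ^ 2 := by gcongr
        _ ≤ 2 * σ ^ 2 + 2 * (2 * r ^ 2 / τ) ^ 2 := by
          nlinarith [sq_nonneg (σ - 2 * r ^ 2 / τ)]
        _ = e := by rw [he]; ring
    simpa using h3
  have hVe : ∫ ω, ‖(Z ω - m) - V.starProjection (Z ω - m)‖ ^ 2 ∂P ≤ e :=
    (hV.2 (T y) hd).trans hKe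
  set b := (T y).starProjection (x - m) with hb
  have key := mul_norm_sub_starProjection_sq_le hX V (T y) hl.le hVe hKe hK
    ((T y).starProjection_apply_mem (x - m))
  rw [← hb] at key
  have hxy : ‖x - y‖ ≤ r := by
    rw [← dist_eq_norm]
    exact hQ₂ hx
  have hbn : ‖b‖ ≤ 2 * r := by
    refine ((T y).norm_starProjection_apply_le _).trans ?_
    have := norm_sub_le (x - y) (m - y)
    rw [sub_sub_sub_cancel_right] at this
    linarith
  have hb2 : ‖b - V.starProjection b‖ ≤
      √(8 * r ^ 2 * (4 * σ ^ 2 + 16 * r ^ 4 / τ ^ 2) / l) := by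
    refine Real.le_sqrt_of_sq_le ?_
    rw [le_div_iff₀ hl]
    calc ‖b - V.starProjection b‖ ^ 2 * l = l * ‖b - V.starProjection b‖ ^ 2 := mul_comm _ _
      _ ≤ 4 * e * ‖b‖ ^ 2 := key
      _ ≤ 4 * e * (2 * r) ^ 2 := by gcongr
      _ = _ := by rw [he]; ring
  have hNx : ‖N (x - m)‖ ≤ 2 * σ + 4 * r ^ 2 / τ := by
    have h1 : N (x - m) = N (x - y) - N (m - y) := by rw [← map_sub, sub_sub_sub_cancel_right]
    have h2 := h.norm_starProjection_orthogonal_le_of_mem_tube hy hσr hx.1 (hQ₂ hx)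
    rw [← hN] at h2
    rw [h1]
    refine (norm_sub_le _ _).trans ((add_le_add h2 hNmr).trans_eq ?_)
    ring
  -- The normal part of `x - m` is small itself; its tangent part `b` is close to `V`.
  have hsplit : x - m - V.starProjection (x - m) =
      Vᗮ.starProjection (N (x - m)) + (b - V.starProjection b) := by
    have h1 : N (x - m) = (x - m) - b := by rw [hN, Submodule.starProjection_orthogonal_val]
    rw [Submodule.starProjection_orthogonal_val, h1, map_sub V.starProjection (x - m) b]
    abel
  rw [hsplit]
  exact (norm_add_le _ _).trans
    (add_le_add ((Vᗮ.norm_starProjection_apply_le _).trans hNx) hb2)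

theorem eigenvalueBound_le_covEigenvalue_and_norm_sub_starProjection_le
    (hd : 1 ≤ d) (hdD : d ≤ D) (hMc : IsCompact M) (hM : IsC2Submanifold d M)
    {r₁ r₂ : ℝ} (hτ : reach M = ENNReal.ofReal τ)
    (hσ : 0 ≤ σ) (hσr : σ < r₁) (hr : r₁ < r₂) (hrτ : r₂ < τ / 8 - σ)
    (hy : y ∈ M) (hQ : MeasurableSet Q)
    (hQ₁ : ball y r₁ ⊆ Q) (hQ₂ : tube M σ ∩ Q ⊆ closedBall y r₂)
    (hZ : HasLaw Z (cond (uniformTube d M σ) Q) P) :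
    eigenvalueBound σ τ d r₁ r₂ ≤ covEigenvalue P Z d hd hdD ∧
    ∀ V : Submodule ℝ (EuclideanSpace ℝ (Fin D)), IsPrincipalSubspace P Z d V →
      ∀ x ∈ tube M σ ∩ Q,
        ‖x - (∫ ω, Z ω ∂P) - V.starProjection (x - ∫ ω, Z ω ∂P)‖
          ≤ 2 * σ + 4 * r₂ ^ 2 / τ +
            r₂ / (r₁ - σ) * √(4 * σ ^ 2 + 16 * r₂ ^ 4 / τ ^ 2) * gammaConst σ τ d r₁ r₂ := by
  have hτ0 : 0 < τ := by linarith
  have hU := unique_nearest_of_reach ⟨y, hy⟩ hτ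
  obtain ⟨T, hT, hTd⟩ := hM.exists_isTangentField
  have h := hT.hasReachGeometry hMc hτ0 hU
  have hZmem := ae_mem_of_hasLaw_cond_uniformTube hMc hQ hZ
  have hZ2 : MemLp Z 2 P := by
    refine MemLp.of_bound hZ.aemeasurable.aestronglyMeasurable (‖y‖ + r₂) ?_
    filter_upwards [hZmem] with ω hω
    exact norm_le_of_mem_closedBall (hQ₂ hω)
  have hl := eigenvalueBound_pos hd hσ hσr hr hrτ
  have hK : ∀ u ∈ T y, eigenvalueBound σ τ d r₁ r₂ * ‖u‖ ^ 2 ≤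
      ∫ ω, ⟪u, Z ω - ∫ ω', Z ω' ∂P⟫_ℝ ^ 2 ∂P := by
    intro u hu
    -- Applied with `s = r₁ - σ`, so that the part of the tube used lies in `ball y (s + σ) = ball y
    -- r₁ ⊆ Q`.
    refine le_trans ?_ (h.eigenvalue_bound_le_integral hU hTd hσ (sub_pos.2 hσr) (by linarith)
      (by linarith : 0 < r₂) (by linarith) hy hQ (by rwa [sub_add_cancel]) hQ₂ hZ hZ2 hu _)
    rw [mul_assoc, mul_comm]
    exact mul_le_mul_of_nonneg_left (eigenvalueBound_le hd hσ hσr hr hrτ) (sq_nonneg _)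
  refine ⟨le_covEigenvalue hZ2 hd hdD (T y) (hTd y hy) hK, fun V hV x hx => ?_⟩
  refine (h.norm_sub_starProjection_le (hTd y hy) hy (by linarith) hσ hQ₂ hZ.aemeasurable hZmem hl
    hK hV hx).trans_eq ?_
  congr 1
  have hs : 0 < r₁ - σ := sub_pos.2 hσr
  have hγ : 0 ≤ gammaConst σ τ d r₁ r₂ := by
    have ha := one_sub_sq_pos hσr (by linarith : r₁ < τ / 8) hσ
    have h1 : 0 < r₂ + σ := by linarith
    have h2 : 0 < 1 - ((r₁ - σ) / (2 * τ)) ^ 2 := by linarith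
    unfold gammaConst
    positivity
  have hr₂ : 0 < r₂ := by linarith
  have hid := eigenvalueBound_mul_gammaConst_sq hd hσ hσr hr hrτ
  rw [Real.sqrt_eq_iff_mul_self_eq (by positivity) (by positivity), ← sq, mul_pow, mul_pow,
    Real.sq_sqrt (by positivity), div_pow, div_eq_iff hl.ne',
    mul_assoc _ (gammaConst σ τ d r₁ r₂ ^ 2), mul_comm (gammaConst σ τ d r₁ r₂ ^ 2), hid]
  field_simp

end PrincipalComponents

end TubeCovariance

theorem mainTheorem6 {D d : ℕ} (hd : 1 ≤ d) (hdD : d ≤ D)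
    (M : Set (EuclideanSpace ℝ (Fin D))) (hMc : IsCompact M) (hM : IsC2Submanifold d M)
    (τ σ r₁ r₂ : ℝ) (hτ : reach M = ENNReal.ofReal τ)
    (hσ : 0 ≤ σ) (hσr : σ < r₁) (hr : r₁ < r₂) (hrτ : r₂ < τ / 8 - σ)
    (y : EuclideanSpace ℝ (Fin D)) (hy : y ∈ M)
    (Q : Set (EuclideanSpace ℝ (Fin D))) (hQ : MeasurableSet Q)
    (hQ₁ : Metric.ball y r₁ ⊆ Q) (hQ₂ : tube M σ ∩ Q ⊆ Metric.closedBall y r₂)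
    {Ω : Type*} [MeasurableSpace Ω] (P : Measure Ω) [IsProbabilityMeasure P]
    (Z : Ω → EuclideanSpace ℝ (Fin D))
    (hZ : HasLaw Z (ProbabilityTheory.cond (uniformTube d M σ) Q) P) :
    1 / (4 * (1 + σ / τ) ^ d) * ((r₁ - σ) / (r₂ + σ)) ^ d *
        ((1 - ((r₁ - σ) / (2 * τ)) ^ 2) /
          (1 + (2 * (r₂ + σ) / (τ - 2 * (r₂ + σ))) ^ 2)) ^ ((d : ℝ) / 2) *
        ((r₁ - σ) ^ 2 / d)
      ≤ covEigenvalue P Z d hd hdD ∧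
    ∀ V : Submodule ℝ (EuclideanSpace ℝ (Fin D)), IsPrincipalSubspace P Z d V →
      ∀ x ∈ tube M σ ∩ Q,
        ‖x - (∫ ω, Z ω ∂P) - V.starProjection (x - ∫ ω, Z ω ∂P)‖
          ≤ 2 * σ + 4 * r₂ ^ 2 / τ +
            r₂ / (r₁ - σ) * √(4 * σ ^ 2 + 16 * r₂ ^ 4 / τ ^ 2) * gammaConst σ τ d r₁ r₂ := by
  exact eigenvalueBound_le_covEigenvalue_and_norm_sub_starProjection_le hd hdD hMc hM hτ hσ hσr hr
    hrτ hy hQ hQ₁ hQ₂ hZ
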